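/- Let $n\ge 3$ and let $\Gamma$ be a connected simple graph whose vertices are the labels $2,\dots,n$; let $K_{n-1}$ be the complete graph on the same vertices. *Bergman side.* Let $v_e$ denote the standard basis vectors of $\mathbb R^{E(K_{n-1})}$, let $L$ be the line spanned by $(1,\dots,1)$, and for a set $F$ of edges let $\rho_F=-\sum_{e\in F}v_e$. The fan $B'(K_{n-1})$ in $\mathbb R^{E(K_{n-1})}/L$ consists of the cones spanned by $\rho_{F_1},\dots,\rho_{F_r}$ for all chains $\emptyset\subsetneq F_1\subsetneq\dots\subsetneq F_r\subsetneq E(K_{n-1})$ ($r\ge 0$) of flats of the cycle matroid of $K_{n-1}$. Let $S$ be the span in $\mathbb R^{E(K_{n-1})}/L$ of the $v_e$ with $e\notin E(\Gamma)$, and let $\mathrm{proj}_\Gamma:\mathbb R^{E(K_{n-1})}/L\to(\mathbb R^{E(K_{n-1})}/L)/S$ be the quotient map. *Moduli side.* A combinatorial type is a finite tree (its edges are called bounded edges) with $n$ labelled ends attached to its vertices such that every vertex has valence at least $3$; a rational $n$-marked tropical curve $C$ is such a type with positive lengths of the bounded edges. Its vector is $d(C)=(\mathrm{dist}(i,j))_{i<j}\in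 Q_n=\mathbb R^{\binom n2}/\Phi(\mathbb R^n)$, where $\mathrm{dist}(i,j)$ is the sum of the lengths of the bounded edges between the ends $i$ and $j$, and $\Phi(x)=(x_i+x_j)_{i<j}$. The root is the vertex carrying the end $1$. $M_{0,n}^{\mathrm{trop}}$ is the collection of the cones $\{d(C)\}$, one for each combinatorial type, where the lengths run over all nonnegative values. A radially aligned combinatorial type is a combinatorial type with a weak ordering of its vertices that is given by the distances from the root for some positive edge lengths; $M_{0,n}^{\mathrm{rad}}$ is the collection of the cones $\{d(C)\}$, one for each radially aligned type, where the lengths run over all nonnegative values for which the distances from the root respect the weak ordering (weakly). A combinatorial type is $\Gamma$-stable if every non-root vertex $V$ with $d$ bounded edges satisfies: $d>2$; or $d=2$ and some end is attached to $V$; or $d=1$ and two ends attached to $V$ are adjacent in $\Gamma$. (The analogous condition at the root, at least two bounded edges or at least one end, always holds.) Let $U\subseteq Q_n$ be the span of the vectors of the curves with exactly one bounded edge that are not $\Gamma$-stable, and let $\widetilde{\mathrm{proj}}_\Gamma:Q_n\to Q_n/U$ be the quotient map. The image of a collection of cones under a linear map is the collection of the image cones; its support is the union of its cones. **Proposition.**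 There is a linear isomorphism $\Psi:Q_n\to\mathbb R^{E(K_{n-1})}/L$ with the following properties. It sends the vector of the curve with a single bounded edge, of length $1$, to $\rho_{K_I}$, where $I$ is the set of ends not attached to the root and $K_I$ is the complete graph on $I$. It sends the cone of each radially aligned type $C$ onto the cone of the chain of flats corresponding to $C$, whose members are, for each positive distance from the root occurring among the vertices, the union of the complete graphs on the end sets of the components that remain when all vertices strictly closer to the root are deleted; and every chain of flats arises so. Moreover $\Psi$ induces a linear isomorphism $\Psi':Q_n/U\to(\mathbb R^{E(K_{n-1})}/L)/S$ with $\Psi'\circ\widetilde{\mathrm{proj}}_\Gamma=\mathrm{proj}_\Gamma\circ\Psi$. Identifying the two quotients by $\Psi'$: 1. $\mathrm{proj}_\Gamma(B'(K_{n-1}))$, $\widetilde{\mathrm{proj}}_\Gamma(M_{0,n}^{\mathrm{rad}})$ and $\widetilde{\mathrm{proj}}_\Gamma(M_{0,n}^{\mathrm{trop}})$ have the same support; 2. $\mathrm{proj}_\Gamma(B'(K_{n-1}))$ and $\widetilde{\mathrm{proj}}_\Gamma(M_{0,n}^{\mathrm{rad}})$ are polyhedral fans, and $\mathrm{proj}_\Gamma(B'(K_{n-1}))=\widetilde{\mathrm{proj}}_\Gamma(M_{0,n}^{\mathrm{rad}})$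 as fans, that is, $\Psi'$ maps the cones of the latter exactly onto the cones of the former. -/

import Mathlib

/-! Throughout, `n = m + 1`.  The ends `1, 2, …, n` of a curve are indexed by `Fin (m + 1)`:
`0` is the distinguished end marked `1`, and `i.succ` for `i : Fin m` are the other ends.  The
vertices of `K_{n-1}` and of `Γ`, which are in bijection with the ends `2, …, n`, are the
elements of `Fin m`. -/

noncomputable section

namespace TropModuli

/-! ### Collections of cones and fans -/

section Fans

variable {V W : Type*} [AddCommGroup V] [Module ℝ V] [AddCommGroup W] [Module ℝ W]

/-- The support of a collection of cones: the union of its cones. -/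
def support (X : Set (PointedCone ℝ V)) : Set V := ⋃ c ∈ X, (c : Set V)

/-- The image of a collection of cones under a linear map: the collection of the image cones. -/
def imageFan (f : V →ₗ[ℝ] W) (X : Set (PointedCone ℝ V)) : Set (PointedCone ℝ W) :=
  PointedCone.map f '' X

/-- Polyhedral fans: finite nonempty collections of finitely generated cones, closed under
taking faces, in which any two cones meet in a common face. -/
structure IsFan (X : Set (PointedCone ℝ V)) : Prop where
  finite : X.Finite
  nonempty : X.Nonempty
  fg : ∀ c ∈ X, Submodule.FG c
  face_mem : ∀ c ∈ X, ∀ f : PointedCone ℝ V, f.IsFaceOf c → f ∈ X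
  inter_face : ∀ c ∈ X, ∀ d ∈ X, (c ⊓ d).IsFaceOf c ∧ (c ⊓ d).IsFaceOf d

end Fans

/-! ### The cycle matroid -/

section CycleMatroid

variable {V : Type*}

/-- `X` is the edge set of a forest contained in `Γ`. -/
def IsForest (Γ : SimpleGraph V) (X : Set (Sym2 V)) : Prop :=
  X ⊆ Γ.edgeSet ∧ (SimpleGraph.fromEdgeSet X).IsAcyclic

theorem isForest_subset {Γ : SimpleGraph V} ⦃I J : Set (Sym2 V)⦄ (hJ : IsForest Γ J)
    (h : I ⊆ J) : IsForest Γ I :=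
  ⟨h.trans hJ.1, hJ.2.anti (SimpleGraph.fromEdgeSet_mono h)⟩

theorem isForest_edgeSet {Γ H : SimpleGraph V} (hle : H ≤ Γ) (hH : H.IsAcyclic) :
    IsForest Γ H.edgeSet :=
  ⟨SimpleGraph.edgeSet_subset_edgeSet.2 hle, by rwa [SimpleGraph.fromEdgeSet_edgeSet]⟩

theorem edgeSet_fromEdgeSet_of_isForest {Γ : SimpleGraph V} {X : Set (Sym2 V)}
    (h : IsForest Γ X) : (SimpleGraph.fromEdgeSet X).edgeSet = X := by
  rw [SimpleGraph.edgeSet_fromEdgeSet, sdiff_eq_left, Set.disjoint_left]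
  intro e he hd
  exact Γ.not_isDiag_of_mem_edgeSet (h.1 he) hd

theorem fromEdgeSet_le_of_isForest {Γ : SimpleGraph V} {X : Set (Sym2 V)}
    (h : IsForest Γ X) : SimpleGraph.fromEdgeSet X ≤ Γ := by
  rw [← SimpleGraph.edgeSet_subset_edgeSet, edgeSet_fromEdgeSet_of_isForest h]
  exact h.1

theorem maximal_isForest_iff {Γ : SimpleGraph V} {X : Set (Sym2 V)} (h : IsForest Γ X) :
    Maximal (IsForest Γ) X ↔
      (SimpleGraph.fromEdgeSet X).Reachable = Γ.Reachable := by
  rw [← SimpleGraph.maximal_isAcyclic_iff_reachable_eq (fromEdgeSet_le_of_isForest h) h.2]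
  constructor
  · intro hX
    refine ⟨⟨fromEdgeSet_le_of_isForest h, h.2⟩, fun H hH hle => ?_⟩
    have h1 : X ⊆ H.edgeSet := by
      rw [← edgeSet_fromEdgeSet_of_isForest h]
      exact SimpleGraph.edgeSet_subset_edgeSet.2 hle
    have h2 := hX.2 (isForest_edgeSet hH.1 hH.2) h1
    have h3 := SimpleGraph.fromEdgeSet_mono h2
    rwa [SimpleGraph.fromEdgeSet_edgeSet] at h3
  · intro hX
    refine ⟨h, fun Y hY hle => ?_⟩
    have h1 := hX.2 ⟨fromEdgeSet_le_of_isForest hY, hY.2⟩ (SimpleGraph.fromEdgeSet_mono hle)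
    rw [← SimpleGraph.edgeSet_subset_edgeSet, edgeSet_fromEdgeSet_of_isForest hY,
      edgeSet_fromEdgeSet_of_isForest h] at h1
    exact h1

theorem isForest_aug {Γ : SimpleGraph V} ⦃I B : Set (Sym2 V)⦄ (hI : IsForest Γ I)
    (hImax : ¬ Maximal (IsForest Γ) I) (hB : Maximal (IsForest Γ) B) :
    ∃ x ∈ B \ I, IsForest Γ (insert x I) := by
  by_contra hcon
  push Not at hcon
  apply hImax
  rw [maximal_isForest_iff hI]
  have hBf : IsForest Γ B := hB.prop
  rw [maximal_isForest_iff hBf] at hB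
  have key : ∀ u v, (SimpleGraph.fromEdgeSet B).Adj u v →
      (SimpleGraph.fromEdgeSet I).Reachable u v := by
    intro u v huv
    rw [SimpleGraph.fromEdgeSet_adj] at huv
    by_contra hn
    have hnI : s(u, v) ∉ I := fun hin =>
      hn (SimpleGraph.Adj.reachable (by rw [SimpleGraph.fromEdgeSet_adj]; exact ⟨hin, huv.2⟩))
    refine hcon s(u, v) ⟨huv.1, hnI⟩ ⟨?_, ?_⟩
    · exact Set.insert_subset (hBf.1 huv.1) hI.1
    · have := SimpleGraph.IsAcyclic.sup_edge_of_not_reachable hn hI.2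
      refine this.anti ?_
      intro a b hab
      rw [SimpleGraph.fromEdgeSet_adj] at hab
      rw [SimpleGraph.sup_adj, SimpleGraph.fromEdgeSet_adj, SimpleGraph.edge_adj]
      rcases hab.1 with h | h
      · right
        refine ⟨?_, hab.2⟩
        simpa using h
      · exact Or.inl ⟨h, hab.2⟩
  ext u v
  refine ⟨fun h => h.mono (fromEdgeSet_le_of_isForest hI), fun h => ?_⟩
  rw [← hB] at h
  obtain ⟨p⟩ := h
  induction p with
  | nil => exact SimpleGraph.Reachable.refl _
  | cons hadj _ ih => exact (key _ _ hadj).trans ih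

/-- The cycle matroid of a finite simple graph: the ground set is the edge set, and the
independent sets are the forests. -/
def cycleMatroid [Finite V] (Γ : SimpleGraph V) : Matroid (Sym2 V) :=
  (IndepMatroid.ofBdd Γ.edgeSet (IsForest Γ)
    ⟨Set.empty_subset _, by simp⟩
    isForest_subset isForest_aug (fun _ h => h.1)
    ⟨Γ.edgeSet.ncard, fun I hI => by
      rw [(Set.toFinite Γ.edgeSet).cast_ncard_eq]
      exact Set.encard_le_encard hI.1⟩).matroid

end CycleMatroid

/-! ### The Bergman fan modulo its lineality space, with the chains-of-flats subdivision -/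

section Bergman

variable {α : Type*} (M : Matroid α)

/-- The line spanned by `(1, …, 1)`. -/
def lineality : Submodule ℝ (M.E → ℝ) := Submodule.span ℝ {fun _ => 1}

/-- `ℝ^{|E|} / L`. -/
abbrev BergmanSpace : Type _ := (M.E → ℝ) ⧸ lineality M

/-- The class of `ρ_F = - ∑_{e ∈ F} v_e` in `ℝ^{|E|} / L`. -/
def flatRay (F : Set α) : BergmanSpace M :=
  (lineality M).mkQ (- Set.indicator {e : M.E | (e : α) ∈ F} 1)

/-- Chains `∅ ⊊ F₁ ⊊ ⋯ ⊊ F_r ⊊ E` of flats, given as the set `{F₁, …, F_r}`. -/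
def IsChainOfFlats (𝓕 : Set (Set α)) : Prop :=
  IsChain (· ⊆ ·) 𝓕 ∧ ∀ F ∈ 𝓕, M.IsFlat F ∧ F.Nonempty ∧ F ≠ M.E

/-- The cone spanned by the rays `ρ_F`, for `F` in the chain `𝓕`. -/
def flatCone (𝓕 : Set (Set α)) : PointedCone ℝ (BergmanSpace M) :=
  PointedCone.hull ℝ (flatRay M '' 𝓕)

/-- The fan `B'(M)`. -/
def bergmanFan : Set (PointedCone ℝ (BergmanSpace M)) :=
  {c | ∃ 𝓕 : Set (Set α), IsChainOfFlats M 𝓕 ∧ c = flatCone M 𝓕}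

end Bergman

/-- The cycle matroid of the complete graph `K_{n-1}`. -/
abbrev matroidK (m : ℕ) : Matroid (Sym2 (Fin m)) := cycleMatroid (⊤ : SimpleGraph (Fin m))

/-! ### The space `Q_n` -/

/-- Pairs `i < j` of ends. -/
abbrev Pairs (n : ℕ) : Type := {p : Fin n × Fin n // p.1 < p.2}

/-- `Φ : x ↦ (x_i + x_j)_{i < j}`. -/
def Phi (n : ℕ) : (Fin n → ℝ) →ₗ[ℝ] (Pairs n → ℝ) where
  toFun x p := x p.1.1 + x p.1.2
  map_add' x y := by ext p; simp; ring
  map_smul' a x := by ext p; simp; ring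

/-- `Q_n = ℝ^{n choose 2} / Φ(ℝ^n)`. -/
abbrev Q (n : ℕ) : Type := (Pairs n → ℝ) ⧸ LinearMap.range (Phi n)

/-! ### Tropical curves -/

/-- Combinatorial types of rational `n`-marked stable tropical curves: finite trees, whose edges
are the bounded edges, with `n` labelled ends attached to the vertices so that every vertex has
valence at least `3`. -/
structure CombType (n : ℕ) where
  /-- the vertices -/
  V : Type
  [finite : Finite V]
  /-- the tree formed by the bounded edges -/
  graph : SimpleGraph V
  isTree : graph.IsTree
  /-- the vertex to which an end is attached -/
  mark : Fin n → V
  stable : ∀ v, 3 ≤ (graph.neighborSet v).ncard + (mark ⁻¹' {v}).ncard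

namespace CombType

attribute [instance] CombType.finite

variable {n : ℕ} (T : CombType n)

/-- The bounded edges. -/
abbrev Edge : Type := T.graph.edgeSet

instance : Fintype T.Edge := Fintype.ofFinite _

/-- The bounded edge `e` lies on the path from `u` to `v`. -/
def OnPath (u v : T.V) (e : T.Edge) : Prop :=
  ∃ p : T.graph.Walk u v, p.IsPath ∧ (e : Sym2 T.V) ∈ p.edges

open Classical in
/-- The distance of `u` and `v` as a linear function of the edge lengths: the sum of the lengths
of all bounded edges between `u` and `v`. -/
def dist (u v : T.V) : (T.Edge → ℝ) →ₗ[ℝ] ℝ :=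
  ∑ e : T.Edge, if T.OnPath u v e then LinearMap.proj e else 0

/-- The vector `d(C) ∈ Q_n` of the curve `C` with combinatorial type `T`, as a linear function
of the edge lengths. -/
def curveVec : (T.Edge → ℝ) →ₗ[ℝ] Q n :=
  (LinearMap.range (Phi n)).mkQ ∘ₗ
    LinearMap.pi fun p : Pairs n => T.dist (T.mark p.1.1) (T.mark p.1.2)

/-- The closed cone of all curves of type `T`, where edge lengths may shrink to `0`. -/
def cone : PointedCone ℝ (Q n) :=
  (PointedCone.positive ℝ (T.Edge → ℝ)).map T.curveVec

end CombType

/-- The fan `M_{0,n}^trop` in `Q_n`. -/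
def tropFan (n : ℕ) : Set (PointedCone ℝ (Q n)) := {c | ∃ T : CombType n, c = T.cone}

/-! ### Radially aligned curves -/

namespace CombType

variable {m : ℕ} (T : CombType (m + 1))

/-- The root vertex, which carries the end marked `1`. -/
def root : T.V := T.mark 0

/-- The distance of a vertex from the root, as a linear function of the edge lengths. -/
def rootDist (v : T.V) : (T.Edge → ℝ) →ₗ[ℝ] ℝ := T.dist T.root v

end CombType

/-- Radially aligned combinatorial types: combinatorial types with a weak ordering of the
vertices that is given by the distances from the root, for some positive edge lengths. -/
structure RadialType (m : ℕ) extends CombType (m + 1) where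
  /-- the weak ordering -/
  le : V → V → Prop
  aligned : ∃ l : toCombType.Edge → ℝ, (∀ e, 0 < l e) ∧
    ∀ u v, le u v ↔ toCombType.rootDist u l ≤ toCombType.rootDist v l

namespace RadialType

variable {m : ℕ} (C : RadialType m)

/-- The closed cone of edge lengths compatible with the weak ordering. -/
def lengths : PointedCone ℝ (C.Edge → ℝ) where
  carrier := {l | (∀ e, 0 ≤ l e) ∧ ∀ u v, C.le u v → C.rootDist u l ≤ C.rootDist v l}
  add_mem' := by
    rintro a b ⟨ha, ha'⟩ ⟨hb, hb'⟩
    refine ⟨fun e => add_nonneg (ha e) (hb e), fun u v h => ?_⟩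
    rw [map_add, map_add]
    exact add_le_add (ha' u v h) (hb' u v h)
  zero_mem' := ⟨fun _ => le_rfl, fun u v _ => by rw [map_zero, map_zero]⟩
  smul_mem' := by
    rintro ⟨c, hc⟩ a ⟨ha, ha'⟩
    refine ⟨fun e => mul_nonneg hc (ha e), fun u v h => ?_⟩
    change C.rootDist u (c • a) ≤ C.rootDist v (c • a)
    rw [map_smul, map_smul]
    exact mul_le_mul_of_nonneg_left (ha' u v h) hc

/-- The closed cone of the radially aligned type `C`. -/
def cone : PointedCone ℝ (Q (m + 1)) := C.lengths.map C.curveVec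

/-- Delete all vertices that are strictly closer to the root than `u` (with their ends and
edges).  The level at `u` is the set of the end sets of the remaining components; this is the
union of the complete graphs on these end sets. -/
def levelFlat (u : C.V) : Set (Sym2 (Fin m)) :=
  {e | ∃ a b : Fin m, a ≠ b ∧ e = s(a, b) ∧
    ∃ (ha : C.le u (C.mark a.succ)) (hb : C.le u (C.mark b.succ)),
      (C.graph.induce {v | C.le u v}).Reachable ⟨C.mark a.succ, ha⟩ ⟨C.mark b.succ, hb⟩}

/-- The chain of flats of `K_{n-1}` that corresponds to `C`: one flat for each positive distance
from the root that occurs. -/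
def levelChain : Set (Set (Sym2 (Fin m))) := {F | ∃ u : C.V, u ≠ C.root ∧ F = C.levelFlat u}

end RadialType

/-- The fan `M_{0,n}^rad` in `Q_n`, for `n = m + 1`. -/
def radFan (m : ℕ) : Set (PointedCone ℝ (Q (m + 1))) := {c | ∃ C : RadialType m, c = C.cone}

/-! ### Graphical stability and the two projections -/

section Projections

variable {m : ℕ} (Γ : SimpleGraph (Fin m))

/-- `Γ`-stability at a non-root vertex. -/
def GammaStableAt (T : CombType (m + 1)) (v : T.V) : Prop :=
  2 < (T.graph.neighborSet v).ncard ∨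
  ((T.graph.neighborSet v).ncard = 2 ∧ (T.mark ⁻¹' {v}).Nonempty) ∨
  ((T.graph.neighborSet v).ncard = 1 ∧
    ∃ i j : Fin m, Γ.Adj i j ∧ T.mark i.succ = v ∧ T.mark j.succ = v)

/-- `Γ`-stability of a combinatorial type. -/
def GammaStable (T : CombType (m + 1)) : Prop :=
  (∀ v, v ≠ T.root → GammaStableAt Γ T v) ∧
  (2 ≤ (T.graph.neighborSet T.root).ncard ∨ (T.mark ⁻¹' {T.root}).Nonempty)

/-- `U ⊆ Q_n`: the linear span of the `Γ`-unstable rays of `M_{0,n}^trop`, that is, of the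
vectors of the `Γ`-unstable curves with a single bounded edge. -/
def unstableSpan : Submodule ℝ (Q (m + 1)) :=
  Submodule.span ℝ {x | ∃ T : CombType (m + 1), T.graph.edgeSet.ncard = 1 ∧
    ¬ GammaStable Γ T ∧ x = T.curveVec (fun _ => 1)}

open Classical in
/-- `S ⊆ ℝ^{|E(K_{n-1})|} / L`: the span of the basis vectors of the edges not in `Γ`. -/
def nonEdgeSpan : Submodule ℝ (BergmanSpace (matroidK m)) :=
  Submodule.span ℝ {x | ∃ e : (matroidK m).E, (e : Sym2 (Fin m)) ∉ Γ.edgeSet ∧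
    x = (lineality (matroidK m)).mkQ (Pi.single e 1)}

/-- The projection `Q_n → Q_n / U`. -/
def projQ : Q (m + 1) →ₗ[ℝ] Q (m + 1) ⧸ unstableSpan Γ := (unstableSpan Γ).mkQ

/-- The projection `ℝ^{|E(K_{n-1})|} / L → ℝ^{|E(K_{n-1})|} / L / S`. -/
def projB : BergmanSpace (matroidK m) →ₗ[ℝ] BergmanSpace (matroidK m) ⧸ nonEdgeSpan Γ :=
  (nonEdgeSpan Γ).mkQ

end Projections

/-- `Ψ` is the isomorphism `Q_n ≅ ℝ^{|E(K_{n-1})|} / L` induced by the correspondence of radially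
aligned combinatorial types and chains of flats. -/
structure IsPsi {m : ℕ} (Ψ : Q (m + 1) ≃ₗ[ℝ] BergmanSpace (matroidK m)) : Prop where
  /-- The curve with one bounded edge, of length `1`, and split `I` goes to `ρ_{K_I}`.  These
  vectors span `Q_n`, so this determines `Ψ`. -/
  ray : ∀ T : CombType (m + 1), T.graph.edgeSet.ncard = 1 →
    Ψ (T.curveVec fun _ => 1) = flatRay (matroidK m)
      {e | ∃ a b : Fin m, a ≠ b ∧ e = s(a, b) ∧ T.mark a.succ ≠ T.root ∧ T.mark b.succ ≠ T.root}
  /-- The cone of a radially aligned type goes to the cone of the corresponding chain of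
  flats. -/
  cone : ∀ C : RadialType m, IsChainOfFlats (matroidK m) C.levelChain ∧
    C.cone.map (Ψ : Q (m + 1) →ₗ[ℝ] BergmanSpace (matroidK m)) =
      flatCone (matroidK m) C.levelChain
  /-- Every chain of flats corresponds to a radially aligned type. -/
  surj : ∀ 𝓕, IsChainOfFlats (matroidK m) 𝓕 → ∃ C : RadialType m, C.levelChain = 𝓕

end TropModuli

end

noncomputable section

namespace TropModuli

/-! ### Cones generated by indicators of a chain of sets -/

section Superlevel

variable {X : Type*}

/-! A curve is read off from the heights of its vertices above the root. For ends `a`, `b` other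
than the root end `0`, the negative Gromov product `(d(a,b) - d(0,a) - d(0,b)) / 2` is minus the
distance from the root to the vertex where the paths to `a` and `b` part. Adding an element of the
image of `Phi` shifts it by a constant, so it defines the isomorphism `psi` (see `psi_curveVec`). By
stability every vertex is such a meet (`CombType.exists_meet_eq`), and the pairs whose meet is at
least as far from the root as `u` form the level flat of `u` (`RadialType.mem_levelFlat_iff`). The
heights that respect an alignment form the cone generated by the indicators of its upper sets
(`RadialType.map_lengths_rootDist`); hence `psi` carries the cone of a radially aligned type to the
cone of its chain. Conversely, the number of members of a chain that contain a pair is a reversed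
ultrametric, and its balls, ordered by reverse inclusion, form the required tree
(`exists_levelChain_eq`).

A curve with one bounded edge and split `I` is unstable exactly when `I` contains no edge of `Γ`, so
its ray lies in `S`; splits with two elements already give all of `S` (`map_psi_unstableSpan`). This
yields the isomorphism of the quotients. Supports agree because nonnegative lengths always respect
the alignment defined by slightly larger lengths (`support_tropFan`).

In the quotient only the values on the edges of `Γ`, up to a common constant, survive. A proper flat
cannot contain all edges of the connected graph `Γ`, so after a change of sign each point of an
image cone has a unique nonnegative representative with minimum `0`. An image cone consists of the
functions whose superlevel sets belong to the chain of traces (`mem_indicatorCone_iff`). Two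
functions in one such cone are comonotone, so superlevel sets of a summand are superlevel sets of
the sum, and a summand lies in every other cone that contains the sum
(`mem_indicatorCone_of_add_mem`). Hence cones meet in common faces; faces themselves come from
subchains. -/

/-- `φ` is nonnegative and all its nonempty superlevel sets at positive heights lie in `𝓖`. -/
def SuperlevelIn (𝓖 : Set (Set X)) (φ : X → ℝ) : Prop :=
  (∀ x, 0 ≤ φ x) ∧ ∀ t, 0 < t → {x | t ≤ φ x} = ∅ ∨ {x | t ≤ φ x} ∈ 𝓖

/-- The cone generated by the indicator functions of the members of `𝓖`. -/
def indicatorCone (𝓖 : Set (Set X)) : PointedCone ℝ (X → ℝ) :=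
  PointedCone.hull ℝ ((fun G : Set X => G.indicator (1 : X → ℝ)) '' 𝓖)

/-- If `φ` and `ψ` ordered `x` and `y` oppositely, the superlevel set of `φ` through `y` and that of
`ψ` through `x` would each contain just one of the two points, so they would be incomparable. -/
theorem SuperlevelIn.comonotone {𝓖 : Set (Set X)} (h𝓖 : IsChain (· ⊆ ·) 𝓖) {φ ψ : X → ℝ}
    (hφ : SuperlevelIn 𝓖 φ) (hψ : SuperlevelIn 𝓖 ψ) {x y : X} (hxy : φ x < φ y) :
    ψ x ≤ ψ y := by
  by_contra! h
  have hy : y ∈ {z | φ y ≤ φ z} := le_refl (φ y)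
  have hx : x ∈ {z | ψ x ≤ ψ z} := le_refl (ψ x)
  have h1 := (hφ.2 (φ y) ((hφ.1 x).trans_lt hxy)).resolve_left (Set.nonempty_of_mem hy).ne_empty
  have h2 := (hψ.2 (ψ x) ((hψ.1 y).trans_lt h)).resolve_left (Set.nonempty_of_mem hx).ne_empty
  rcases h𝓖.total h1 h2 with h3 | h3
  · exact absurd (h3 hy) (not_le.2 h)
  · exact absurd (h3 hx) (not_le.2 hxy)

theorem exists_min_of_nonempty [Finite X] (φ : X → ℝ) {s : Set X} (hs : s.Nonempty) :
    ∃ x ∈ s, ∀ y ∈ s, φ x ≤ φ y :=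
  Set.exists_min_image s φ s.toFinite hs

/-- By comonotonicity a superlevel set of the sum is the intersection of the superlevel sets of `φ`
and `ψ` through a minimizing point, and in a chain an intersection of two members is one of them. -/
theorem SuperlevelIn.add [Finite X] {𝓖 : Set (Set X)} (h𝓖 : IsChain (· ⊆ ·) 𝓖) {φ ψ : X → ℝ}
    (hφ : SuperlevelIn 𝓖 φ) (hψ : SuperlevelIn 𝓖 ψ) : SuperlevelIn 𝓖 (φ + ψ) := by
  refine ⟨fun x => add_nonneg (hφ.1 x) (hψ.1 x), fun t ht => ?_⟩
  rcases Set.eq_empty_or_nonempty {x | t ≤ (φ + ψ) x} with h | h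
  · exact Or.inl h
  right
  obtain ⟨x, hx, hmin⟩ := exists_min_of_nonempty (φ + ψ) h
  have heq : {y | t ≤ (φ + ψ) y} = {y | φ x ≤ φ y} ∩ {y | ψ x ≤ ψ y} := by
    ext y
    constructor
    · intro hy
      have h1 : φ x + ψ x ≤ φ y + ψ y := hmin y hy
      constructor
      · by_contra hc
        have hc : φ y < φ x := not_le.1 hc
        have := hφ.comonotone h𝓖 hψ hc
        linarith
      · by_contra hc
        have hc : ψ y < ψ x := not_le.1 hc
        have := hψ.comonotone h𝓖 hφ hc
        linarith
    · rintro ⟨h1, h2⟩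
      have h1 : φ x ≤ φ y := h1
      have h2 : ψ x ≤ ψ y := h2
      exact le_trans hx (add_le_add h1 h2)
  have hne : x ∈ {y | φ x ≤ φ y} := le_refl (φ x)
  have hne' : x ∈ {y | ψ x ≤ ψ y} := le_refl (ψ x)
  rw [heq]
  -- At height `0` the superlevel set is everything, which need not belong to `𝓖`. It can be
  -- dropped, and since `0 < t` this does not happen for both functions.
  rcases (hφ.1 x).eq_or_lt with h0 | h0
  · have : {y | φ x ≤ φ y} = Set.univ := by
      ext y
      simpa [← h0] using hφ.1 y
    rw [this, Set.univ_inter]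
    have hpos : 0 < ψ x := by
      have : t ≤ φ x + ψ x := hx
      linarith
    exact (hψ.2 _ hpos).resolve_left (Set.nonempty_of_mem hne').ne_empty
  · have h1 := (hφ.2 _ h0).resolve_left (Set.nonempty_of_mem hne).ne_empty
    rcases (hψ.1 x).eq_or_lt with h0' | h0'
    · have : {y | ψ x ≤ ψ y} = Set.univ := by
        ext y
        simpa [← h0'] using hψ.1 y
      rwa [this, Set.inter_univ]
    · have h2 := (hψ.2 _ h0').resolve_left (Set.nonempty_of_mem hne').ne_empty
      rcases h𝓖.total h1 h2 with h3 | h3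
      · rwa [Set.inter_eq_left.2 h3]
      · rwa [Set.inter_eq_right.2 h3]

theorem superlevelIn_of_mem_indicatorCone [Finite X] {𝓖 : Set (Set X)}
    (h𝓖 : IsChain (· ⊆ ·) 𝓖) {φ : X → ℝ} (hφ : φ ∈ indicatorCone 𝓖) : SuperlevelIn 𝓖 φ := by
  classical
  refine Submodule.span_induction ?_ ?_ ?_ ?_ hφ
  · rintro _ ⟨G, hG, rfl⟩
    refine ⟨fun x => Set.indicator_nonneg (fun _ _ => zero_le_one) x, fun t ht => ?_⟩
    by_cases h1 : t ≤ 1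
    · right
      convert hG using 1
      ext x
      by_cases hx : x ∈ G
      · simp [hx, h1]
      · simp [hx, ht]
    · left
      ext x
      by_cases hx : x ∈ G
      · simp [hx, h1]
      · simp [hx, ht]
  · refine ⟨fun x => le_refl _, fun t ht => Or.inl ?_⟩
    ext x
    simpa using ht
  · intro x y _ _ hx hy
    exact hx.add h𝓖 hy
  · rintro ⟨a, ha⟩ x _ hx
    have ha : 0 ≤ a := ha
    refine ⟨fun y => mul_nonneg ha (hx.1 y), fun t ht => ?_⟩
    rcases ha.eq_or_lt with h0 | h0
    · left
      refine Set.eq_empty_of_forall_notMem fun y hy => ?_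
      have hy : t ≤ a * x y := hy
      rw [← h0, zero_mul] at hy
      exact absurd ht (not_lt.2 hy)
    · have : {y | t ≤ ((⟨a, ha⟩ : {c : ℝ // 0 ≤ c}) • x) y} = {y | t / a ≤ x y} := by
        ext y
        change t ≤ a * x y ↔ t / a ≤ x y
        rw [div_le_iff₀' h0]
      rw [this]
      exact hx.2 _ (div_pos ht h0)

/-- Layer-cake decomposition: subtract the least positive value times the indicator of its
superlevel set. The superlevel sets of the rest are those of `φ` at shifted heights, and the set of
positivity shrinks. -/
theorem mem_indicatorCone_of_superlevelIn [Finite X] {𝓖 : Set (Set X)} {φ : X → ℝ}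
    (hφ : SuperlevelIn 𝓖 φ) : φ ∈ indicatorCone 𝓖 := by
  classical
  induction hn : {x | 0 < φ x}.ncard using Nat.strong_induction_on generalizing φ with
  | _ n ih =>
  rcases Set.eq_empty_or_nonempty {x | 0 < φ x} with h | h
  · have : φ = 0 := by
      ext x
      have : x ∉ {x | 0 < φ x} := by rw [h]; exact Set.notMem_empty x
      exact le_antisymm (not_lt.1 this) (hφ.1 x)
    rw [this]
    exact zero_mem _
  obtain ⟨x, hx, hmin⟩ := exists_min_of_nonempty φ h
  have hx : 0 < φ x := hx
  have hG : {y | φ x ≤ φ y} ∈ 𝓖 :=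
    (hφ.2 _ hx).resolve_left
      (Set.nonempty_of_mem (show x ∈ {y | φ x ≤ φ y} from le_refl (φ x))).ne_empty
  set G := {y | φ x ≤ φ y} with hGdef
  have hout : ∀ y, y ∉ G → φ y = 0 := by
    intro y hy
    by_contra hne
    exact hy (hmin y ((hφ.1 y).lt_of_ne' hne))
  have hval : ∀ y, (φ - φ x • G.indicator (1 : X → ℝ)) y = if y ∈ G then φ y - φ x else 0 := by
    intro y
    by_cases hy : y ∈ G
    · simp [hy]
    · simp [hy, hout y hy]
  have hnew : SuperlevelIn 𝓖 (φ - φ x • G.indicator (1 : X → ℝ)) := by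
    refine ⟨fun y => ?_, fun t ht => ?_⟩
    · rw [hval]
      split_ifs with hy
      · exact sub_nonneg.2 hy
      · exact le_rfl
    · have : {y | t ≤ (φ - φ x • G.indicator (1 : X → ℝ)) y} = {y | t + φ x ≤ φ y} := by
        ext y
        rw [Set.mem_ofPred_eq, Set.mem_ofPred_eq, hval]
        split_ifs with hy
        · exact le_sub_iff_add_le
        · rw [hout y hy]
          constructor <;> intro h <;> linarith
      rw [this]
      exact hφ.2 _ (add_pos ht hx)
  have hlt : {y | 0 < (φ - φ x • G.indicator (1 : X → ℝ)) y}.ncard < n := by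
    rw [← hn]
    refine Set.ncard_lt_ncard ⟨fun y hy => ?_, fun hsub => ?_⟩ (Set.toFinite _)
    · rw [Set.mem_ofPred_eq, hval] at hy
      split_ifs at hy with h'
      · exact hx.trans_le h'
      · exact absurd hy (lt_irrefl _)
    · have := hsub (show x ∈ {x | 0 < φ x} from hx)
      rw [Set.mem_ofPred_eq, hval, if_pos (show x ∈ G from le_refl (φ x))] at this
      simp at this
  have h1 := ih _ hlt hnew rfl
  have h2 : φ x • G.indicator (1 : X → ℝ) ∈ indicatorCone 𝓖 :=
    PointedCone.smul_mem _ hx.le (Submodule.subset_span ⟨G, hG, rfl⟩)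
  simpa using add_mem h1 h2

theorem mem_indicatorCone_iff [Finite X] {𝓖 : Set (Set X)} (h𝓖 : IsChain (· ⊆ ·) 𝓖)
    {φ : X → ℝ} : φ ∈ indicatorCone 𝓖 ↔ SuperlevelIn 𝓖 φ :=
  ⟨superlevelIn_of_mem_indicatorCone h𝓖, mem_indicatorCone_of_superlevelIn⟩

/-- Let `x` minimize `φ + ψ` on `{t ≤ φ}`. Outside this set `φ` is smaller than at `x` and, by
comonotonicity, `ψ` is not larger, so `{t ≤ φ}` is the superlevel set of `φ + ψ` through `x`. -/
theorem mem_indicatorCone_of_add_mem [Finite X] {𝓖 𝓗 : Set (Set X)} (h𝓖 : IsChain (· ⊆ ·) 𝓖)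
    (h𝓗 : IsChain (· ⊆ ·) 𝓗) {φ ψ : X → ℝ} (hφ : φ ∈ indicatorCone 𝓖)
    (hψ : ψ ∈ indicatorCone 𝓖) (h : φ + ψ ∈ indicatorCone 𝓗) : φ ∈ indicatorCone 𝓗 := by
  rw [mem_indicatorCone_iff h𝓖] at hφ hψ
  rw [mem_indicatorCone_iff h𝓗] at h ⊢
  refine ⟨hφ.1, fun t ht => ?_⟩
  rcases Set.eq_empty_or_nonempty {x | t ≤ φ x} with h0 | h0
  · exact Or.inl h0
  right
  obtain ⟨x, hx, hmin⟩ := exists_min_of_nonempty (φ + ψ) h0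
  have hx : t ≤ φ x := hx
  have hpos : 0 < (φ + ψ) x := by
    have := hψ.1 x
    change 0 < φ x + ψ x
    linarith
  have heq : {y | t ≤ φ y} = {y | (φ + ψ) x ≤ (φ + ψ) y} := by
    ext y
    refine ⟨fun hy => hmin y hy, fun hy => ?_⟩
    by_contra hc
    have hc : φ y < t := not_le.1 hc
    have := hφ.comonotone h𝓖 hψ (hc.trans_le hx)
    have hy : φ x + ψ x ≤ φ y + ψ y := hy
    linarith
  rw [heq]
  exact (h.2 _ hpos).resolve_left
    (Set.nonempty_of_mem (show x ∈ {y | (φ + ψ) x ≤ (φ + ψ) y} from le_refl ((φ + ψ) x))).ne_empty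

/-- The superlevel set at the minimum value is everything, which is excluded from `𝓖`; so this value
is not positive. -/
theorem exists_eq_zero_of_mem_indicatorCone [Finite X] [Nonempty X] {𝓖 : Set (Set X)}
    (h𝓖 : IsChain (· ⊆ ·) 𝓖) (huniv : Set.univ ∉ 𝓖) {φ : X → ℝ} (hφ : φ ∈ indicatorCone 𝓖) :
    ∃ x, φ x = 0 := by
  rw [mem_indicatorCone_iff h𝓖] at hφ
  obtain ⟨x, -, hmin⟩ := exists_min_of_nonempty φ (Set.univ_nonempty (α := X))
  refine ⟨x, ?_⟩
  by_contra hne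
  have hu : {y | φ x ≤ φ y} = Set.univ := Set.eq_univ_of_forall fun y => hmin y trivial
  have := hφ.2 _ ((hφ.1 x).lt_of_ne' hne)
  rw [hu] at this
  exact huniv (this.resolve_left Set.univ_nonempty.ne_empty)

end Superlevel

/-! ### Faces of cones given by generators -/

section Hull

variable {V W : Type*} [AddCommGroup V] [Module ℝ V] [AddCommGroup W] [Module ℝ W]

theorem map_hull (f : V →ₗ[ℝ] W) (s : Set V) :
    (PointedCone.hull ℝ s).map f = PointedCone.hull ℝ (f '' s) :=
  Submodule.map_span _ _

/-- If a nonnegative combination of generators lies in a face, then so does each generator with a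
positive coefficient. -/
theorem eq_hull_inter_of_isFaceOf_hull {s : Set V} {F : PointedCone ℝ V}
    (hF : F.IsFaceOf (PointedCone.hull ℝ s)) : F = PointedCone.hull ℝ (s ∩ F) := by
  apply le_antisymm
  · have key : ∀ x ∈ PointedCone.hull ℝ s, x ∈ F → x ∈ PointedCone.hull ℝ (s ∩ F) := by
      intro x hx
      refine Submodule.closure_induction (p := fun x _ => x ∈ F → x ∈ PointedCone.hull ℝ (s ∩ F))
        ?_ ?_ ?_ hx
      · intro _
        exact zero_mem _
      · intro x y hx hy ihx ihy hxy
        rw [hF.add_mem_iff_mem hx hy] at hxy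
        exact add_mem (ihx hxy.1) (ihy hxy.2)
      · rintro ⟨a, ha⟩ x hx hax
        have ha : 0 ≤ a := ha
        rcases ha.eq_or_lt with h0 | h0
        · subst h0
          have : ((⟨0, ha⟩ : {c : ℝ // 0 ≤ c}) • x) = 0 := zero_smul ℝ x
          rw [this]
          exact zero_mem _
        · have hxF : x ∈ F := hF.mem_of_smul_add_mem (PointedCone.subset_hull hx) (zero_mem _) h0
            (by rw [add_zero]; exact hax)
          exact PointedCone.smul_mem _ ha (PointedCone.subset_hull ⟨hx, hxF⟩)
    exact fun x hx => key x (hF.le hx) hx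
  · exact Submodule.span_le.2 fun x hx => hx.2

end Hull

/-! ### Flats of the cycle matroid of the complete graph -/

section Flats

variable {V : Type*} [Finite V]

theorem mk_mem_ground_cycleMatroid_top {a b : V} :
    s(a, b) ∈ (cycleMatroid (⊤ : SimpleGraph V)).E ↔ a ≠ b :=
  Iff.rfl

theorem cycleMatroid_indep_iff {Γ : SimpleGraph V} {I : Set (Sym2 V)} :
    (cycleMatroid Γ).Indep I ↔ IsForest Γ I := Iff.rfl

/-- Adding an edge to a forest creates a cycle exactly when its ends are already connected. -/
theorem mem_closure_iff_reachable {I : Set (Sym2 V)} (hI : IsForest (⊤ : SimpleGraph V) I)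
    {a b : V} (hab : a ≠ b) :
    s(a, b) ∈ (cycleMatroid (⊤ : SimpleGraph V)).closure I ↔
      (SimpleGraph.fromEdgeSet I).Reachable a b := by
  have hE : s(a, b) ∈ (cycleMatroid (⊤ : SimpleGraph V)).E :=
    mk_mem_ground_cycleMatroid_top.2 hab
  rw [(cycleMatroid_indep_iff.2 hI).mem_closure_iff', cycleMatroid_indep_iff]
  have hins : SimpleGraph.fromEdgeSet (insert s(a, b) I) =
      SimpleGraph.fromEdgeSet I ⊔ SimpleGraph.edge a b := by
    ext u v
    simp only [SimpleGraph.fromEdgeSet_adj, SimpleGraph.sup_adj, SimpleGraph.edge_adj,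
      Set.mem_insert_iff, Sym2.eq_iff]
    tauto
  have hf : IsForest (⊤ : SimpleGraph V) (insert s(a, b) I) ↔
      ((SimpleGraph.fromEdgeSet I).Reachable a b → s(a, b) ∈ I) := by
    rw [IsForest, hins, SimpleGraph.isAcyclic_sup_fromEdgeSet_iff, Set.insert_subset_iff,
      SimpleGraph.fromEdgeSet_adj]
    have h1 := hI.1
    have h2 := hI.2
    have h3 : s(a, b) ∈ (⊤ : SimpleGraph V).edgeSet := hE
    tauto
  rw [hf]
  constructor
  · rintro ⟨-, h⟩
    by_contra hn
    exact hn (SimpleGraph.Adj.reachable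
      ((SimpleGraph.fromEdgeSet_adj I).2 ⟨h fun hr => absurd hr hn, hab⟩))
  · intro hr
    exact ⟨hE, fun h => h hr⟩

theorem mem_of_reachable_fromEdgeSet {V : Type*} {F : Set (Sym2 V)}
    (hF : ∀ a b c : V, s(a, b) ∈ F → s(b, c) ∈ F → a ≠ c → s(a, c) ∈ F) {a b : V} (hab : a ≠ b)
    (h : (SimpleGraph.fromEdgeSet F).Reachable a b) : s(a, b) ∈ F := by
  obtain ⟨p⟩ := h
  induction p with
  | nil => exact absurd rfl hab
  | @cons u v w hadj q ih =>
    have h1 := ((SimpleGraph.fromEdgeSet_adj F).1 hadj).1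
    by_cases hvw : v = w
    · exact hvw ▸ h1
    · exact hF _ _ _ h1 (ih hvw) hab

/-- The closure of `F` is the connectivity relation of a basis of `F`. This relation is transitive,
and a transitive `F` absorbs the ends of every path in it. -/
theorem isFlat_cycleMatroid_top_iff {F : Set (Sym2 V)} :
    (cycleMatroid (⊤ : SimpleGraph V)).IsFlat F ↔ F ⊆ (⊤ : SimpleGraph V).edgeSet ∧
      ∀ a b c : V, s(a, b) ∈ F → s(b, c) ∈ F → a ≠ c → s(a, c) ∈ F := by
  have hcl : F ⊆ (⊤ : SimpleGraph V).edgeSet → ∃ I, I ⊆ F ∧ ∀ a b, a ≠ b →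
      (s(a, b) ∈ (cycleMatroid (⊤ : SimpleGraph V)).closure F ↔
        (SimpleGraph.fromEdgeSet I).Reachable a b) := by
    intro hsub
    obtain ⟨I, hI⟩ := (cycleMatroid (⊤ : SimpleGraph V)).exists_isBasis F hsub
    refine ⟨I, hI.subset, fun a b hab => ?_⟩
    rw [← hI.closure_eq_closure]
    exact mem_closure_iff_reachable hI.indep hab
  constructor
  · intro h
    have hsub : F ⊆ (⊤ : SimpleGraph V).edgeSet := h.subset_ground
    refine ⟨hsub, fun a b c hab hbc hac => ?_⟩
    obtain ⟨I, -, hI⟩ := hcl hsub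
    rw [h.closure] at hI
    have h1 : a ≠ b := by simpa using hsub hab
    have h2 : b ≠ c := by simpa using hsub hbc
    exact (hI a c hac).2 (((hI a b h1).1 hab).trans ((hI b c h2).1 hbc))
  · rintro ⟨hsub, htr⟩
    obtain ⟨I, hIF, hI⟩ := hcl hsub
    rw [Matroid.isFlat_iff_closure_eq]
    refine Set.Subset.antisymm (fun e he => ?_)
      ((cycleMatroid (⊤ : SimpleGraph V)).subset_closure F hsub)
    have heE : e ∈ (⊤ : SimpleGraph V).edgeSet :=
      (cycleMatroid (⊤ : SimpleGraph V)).closure_subset_ground F he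
    induction e with
    | _ a b =>
    have hab : a ≠ b := by simpa using heE
    exact mem_of_reachable_fromEdgeSet htr hab
      (((hI a b hab).1 he).mono (SimpleGraph.fromEdgeSet_mono hIF))

end Flats

/-! ### Rooted trees -/

section RootedTrees

variable {V : Type*} {G : SimpleGraph V}

/-- Every walk from `u` to `v` uses the edge `e`. -/
def Separates (G : SimpleGraph V) (e : Sym2 V) (u v : V) : Prop :=
  ∀ p : G.Walk u v, e ∈ p.edges

/-- `x` is an ancestor of `y` with respect to the root `r`: every edge between `r` and `x` lies
between `r` and `y`. -/
def IsAncestor (G : SimpleGraph V) (r x y : V) : Prop :=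
  ∀ e, Separates G e r x → Separates G e r y

/-- `p` is the neighbour of `v` that is closer to the root `r`. -/
def IsParent (G : SimpleGraph V) (r p v : V) : Prop :=
  G.Adj p v ∧ ¬ Separates G s(p, v) r p

/-- `c` is the last common vertex of the paths from the root `r` to `a` and to `b`. -/
def IsMeet (G : SimpleGraph V) (r c a b : V) : Prop :=
  ∀ e, Separates G e r c ↔ Separates G e r a ∧ Separates G e r b

theorem not_separates_self (e : Sym2 V) (u : V) : ¬ Separates G e u u :=
  fun h => by simpa using h SimpleGraph.Walk.nil

theorem Separates.symm {e : Sym2 V} {u v : V} (h : Separates G e u v) : Separates G e v u :=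
  fun p => by simpa using h p.reverse

theorem Separates.left_or_right {e : Sym2 V} {u v : V} (h : Separates G e u v) (w : V) :
    Separates G e u w ∨ Separates G e w v := by
  by_contra! hc
  simp only [Separates, not_forall] at hc
  obtain ⟨⟨p, hp⟩, q, hq⟩ := hc
  have := h (p.append q)
  rw [SimpleGraph.Walk.edges_append, List.mem_append] at this
  tauto

theorem not_separates_of_adj {e : Sym2 V} {u v : V} (h : G.Adj u v) (hne : e ≠ s(u, v)) :
    ¬ Separates G e u v := fun hs => by
  have := hs (SimpleGraph.Walk.cons h SimpleGraph.Walk.nil)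
  simp [hne] at this

theorem IsAncestor.refl (r x : V) : IsAncestor G r x x := fun _ => id

theorem IsAncestor.trans {r x y z : V} (h : IsAncestor G r x y) (h' : IsAncestor G r y z) :
    IsAncestor G r x z := fun e he => h' e (h e he)

theorem isAncestor_root (r x : V) : IsAncestor G r r x :=
  fun e he => absurd he (not_separates_self e r)

theorem IsMeet.ancestor_left {r c a b : V} (h : IsMeet G r c a b) : IsAncestor G r c a :=
  fun e he => ((h e).1 he).1

theorem IsMeet.ancestor_right {r c a b : V} (h : IsMeet G r c a b) : IsAncestor G r c b :=
  fun e he => ((h e).1 he).2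

theorem IsMeet.ancestor {r c a b x : V} (h : IsMeet G r c a b) (ha : IsAncestor G r x a)
    (hb : IsAncestor G r x b) : IsAncestor G r x c :=
  fun e he => (h e).2 ⟨ha e he, hb e he⟩

/-- A walk from `r` to `v` that avoids `f` still runs through `e`, hence through `x`, and its part
up to `x` is a walk that avoids `f`. -/
theorem isAncestor_of_mem_of_separates {r x v : V} {e : Sym2 V} (he : Separates G e r v)
    (hx : x ∈ e) : IsAncestor G r x v := by
  classical
  intro f hf
  by_contra hc
  simp only [Separates, not_forall] at hc
  obtain ⟨p, hp⟩ := hc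
  have hxs : x ∈ p.support := by
    induction e with
    | _ a b =>
    rcases Sym2.mem_iff.1 hx with rfl | rfl
    · exact p.fst_mem_support_of_mem_edges (he p)
    · exact p.snd_mem_support_of_mem_edges (he p)
  exact hp (p.edges_takeUntil_subset_edges hxs (hf (p.takeUntil x hxs)))

variable (hG : G.IsTree)

include hG

theorem separates_of_adj {u v : V} (h : G.Adj u v) : Separates G s(u, v) u v :=
  SimpleGraph.isBridge_iff_forall_walk_mem_edges.1
    (SimpleGraph.isAcyclic_iff_forall_isBridge.1 hG.isAcyclic h)

theorem separates_of_isPath {e : Sym2 V} {u v : V} {p : G.Walk u v} (hp : p.IsPath)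
    (he : e ∈ p.edges) : Separates G e u v := by
  classical
  intro q
  have : p = q.bypass := (hG.existsUnique_path u v).unique hp q.bypass_isPath
  exact q.edges_bypass_subset_edges (this ▸ he)

theorem exists_isPath_mem_edges_iff {e : Sym2 V} {u v : V} :
    (∃ p : G.Walk u v, p.IsPath ∧ e ∈ p.edges) ↔ Separates G e u v := by
  constructor
  · rintro ⟨p, hp, he⟩
    exact separates_of_isPath hG hp he
  · intro h
    obtain ⟨p, hp, -⟩ := hG.existsUnique_path u v
    exact ⟨p, hp, h p⟩

theorem not_separates_left_or_right {a b : V} (v : V) :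
    ¬ Separates G s(a, b) v a ∨ ¬ Separates G s(a, b) v b := by
  obtain ⟨p⟩ := hG.connected.preconnected v a
  induction p with
  | nil => exact Or.inl (not_separates_self _ _)
  | @cons u w z hadj q ih =>
    by_cases he : s(z, b) = s(u, w)
    · rcases Sym2.eq_iff.1 he with ⟨rfl, rfl⟩ | ⟨rfl, rfl⟩
      · exact Or.inl (not_separates_self _ _)
      · exact Or.inr (not_separates_self _ _)
    · have h1 := not_separates_of_adj hadj he
      rcases ih with h | h
      · exact Or.inl fun hs => (hs.left_or_right w).elim h1 h
      · exact Or.inr fun hs => (hs.left_or_right w).elim h1 h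

/-- Deleting an edge of a tree leaves two sides, so separation is determined by comparing each
vertex with `r`. -/
theorem separates_iff_not_iff {e : Sym2 V} (he : e ∈ G.edgeSet) (r u v : V) :
    Separates G e u v ↔ ¬ (Separates G e r u ↔ Separates G e r v) := by
  induction e with
  | _ a b =>
  have hab := separates_of_adj hG (show G.Adj a b from he)
  have hr := not_separates_left_or_right hG (a := a) (b := b) r
  have hu := not_separates_left_or_right hG (a := a) (b := b) u
  have hv := not_separates_left_or_right hG (a := a) (b := b) v
  have tr : ∀ x y z, ¬ Separates G s(a, b) x y → ¬ Separates G s(a, b) y z →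
      ¬ Separates G s(a, b) x z := fun x y z h1 h2 h => (h.left_or_right y).elim h1 h2
  have sy : ∀ x y, ¬ Separates G s(a, b) x y → ¬ Separates G s(a, b) y x :=
    fun x y h h' => h h'.symm
  constructor
  · intro h hiff
    by_cases hru : Separates G s(a, b) r u
    · have hrv := hiff.1 hru
      rcases hr with hr | hr <;> rcases hu with hu | hu <;> rcases hv with hv | hv <;> grind
    · exact tr _ _ _ (sy _ _ hru) (fun h' => hru (hiff.2 h')) h
  · intro hiff
    by_contra h
    apply hiff
    constructor
    · intro h1
      by_contra h2
      exact tr _ _ _ h2 (sy _ _ h) h1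
    · intro h1
      by_contra h2
      exact tr _ _ _ h2 h h1

theorem isParent_or_isParent (r : V) {u v : V} (h : G.Adj u v) :
    IsParent G r u v ∨ IsParent G r v u := by
  have h1 := (separates_iff_not_iff hG h r u v).1 (separates_of_adj hG h)
  by_cases hu : Separates G s(u, v) r u
  · refine Or.inr ⟨h.symm, fun hv => h1 ?_⟩
    rw [Sym2.eq_swap] at hv
    exact ⟨fun _ => hv, fun _ => hu⟩
  · exact Or.inl ⟨h, hu⟩

theorem IsParent.separates_iff {r p v : V} (h : IsParent G r p v) (e : Sym2 V) :
    Separates G e r v ↔ Separates G e r p ∨ e = s(p, v) := by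
  by_cases he : e = s(p, v)
  · subst he
    have h1 := (separates_iff_not_iff hG h.1 r p v).1 (separates_of_adj hG h.1)
    have h2 := h.2
    tauto
  · have h1 := not_separates_of_adj h.1 he
    have h2 := not_separates_of_adj h.1.symm (by rwa [Sym2.eq_swap] at he)
    simp only [he, or_false]
    constructor
    · intro h
      exact (h.left_or_right p).resolve_right h1
    · intro h
      exact (h.left_or_right v).resolve_right h2

theorem IsParent.separates {r p v : V} (h : IsParent G r p v) : Separates G s(p, v) r v :=
  (h.separates_iff hG _).2 (Or.inr rfl)

theorem IsParent.ancestor {r p v : V} (h : IsParent G r p v) : IsAncestor G r p v :=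
  fun e he => (h.separates_iff hG e).2 (Or.inl he)

theorem IsParent.asymm {r p v : V} (h : IsParent G r p v) : ¬ IsParent G r v p := fun h' =>
  h.2 (by rw [Sym2.eq_swap]; exact h'.separates hG)

theorem IsParent.ne_root {r p v : V} (h : IsParent G r p v) : v ≠ r := by
  rintro rfl
  exact not_separates_self _ _ (h.separates hG)

/-- Induction on the path to the root. Its first step leads to the parent, because the remaining
path never returns to `v` and so avoids the first edge. -/
theorem parent_induction {r : V} {motive : V → Prop} (root : motive r)
    (step : ∀ p v, IsParent G r p v → motive p → motive v) (v : V) : motive v := by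
  obtain ⟨p, hp, -⟩ := hG.existsUnique_path v r
  induction p with
  | nil => exact root
  | cons hadj q ih =>
    rw [SimpleGraph.Walk.cons_isPath_iff] at hp
    refine step _ _ ⟨hadj.symm, fun hs => hp.2 ?_⟩ (ih root step hp.1)
    have := hs q.reverse
    rw [SimpleGraph.Walk.edges_reverse, List.mem_reverse] at this
    exact q.snd_mem_support_of_mem_edges this

theorem exists_isParent {r v : V} (hv : v ≠ r) : ∃ p, IsParent G r p v := by
  refine parent_induction hG (r := r) (motive := fun v => v ≠ r → ∃ p, IsParent G r p v)
    (fun h => absurd rfl h) (fun p v h _ _ => ⟨p, h⟩) v hv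

/-- The first edge of a path from `x` to `y` would separate exactly one of them from `r`. -/
theorem IsAncestor.antisymm {r x y : V} (h : IsAncestor G r x y) (h' : IsAncestor G r y x) :
    x = y := by
  obtain ⟨p, hp, -⟩ := hG.existsUnique_path x y
  cases p with
  | nil => rfl
  | @cons _ w _ hadj q =>
    have h1 := separates_of_isPath hG hp (e := s(x, w)) (by simp)
    exact absurd ⟨h _, h' _⟩ ((separates_iff_not_iff hG hadj r x y).1 h1)

theorem IsParent.unique {r p q v : V} (hp : IsParent G r p v) (hq : IsParent G r q v) : p = q := by
  by_cases he : s(q, v) = s(p, v)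
  · exact (Sym2.congr_left.1 he).symm
  · have h1 := ((hp.separates_iff hG _).1 (hq.separates hG)).resolve_right he
    exact absurd (isAncestor_of_mem_of_separates h1 (Sym2.mem_mk_right q v) _
      (hp.separates hG)) hp.2

theorem IsParent.separates_iff_isAncestor {r p v w : V} (h : IsParent G r p v) :
    Separates G s(p, v) r w ↔ IsAncestor G r v w :=
  ⟨fun hs => isAncestor_of_mem_of_separates hs (Sym2.mem_mk_right p v),
    fun ha => ha _ (h.separates hG)⟩

theorem IsParent.not_isAncestor {r p v : V} (h : IsParent G r p v) : ¬ IsAncestor G r v p :=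
  fun ha => h.2 ((h.separates_iff_isAncestor hG).2 ha)

theorem IsAncestor.of_isParent {r x p v : V} (h : IsAncestor G r x v) (hne : x ≠ v)
    (hp : IsParent G r p v) : IsAncestor G r x p := by
  by_cases hx : x = r
  · subst hx
    exact isAncestor_root x p
  obtain ⟨q, hq⟩ := exists_isParent hG hx
  rcases (hp.separates_iff hG _).1 ((hq.separates_iff_isAncestor hG).2 h) with h1 | h1
  · exact (hq.separates_iff_isAncestor hG).1 h1
  · rcases Sym2.eq_iff.1 h1 with ⟨-, h2⟩ | ⟨-, rfl⟩
    · exact absurd h2 hne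
    · exact IsAncestor.refl r x

theorem IsAncestor.total {r x y v : V} (hx : IsAncestor G r x v) (hy : IsAncestor G r y v) :
    IsAncestor G r x y ∨ IsAncestor G r y x := by
  refine parent_induction hG (r := r) (motive := fun v => IsAncestor G r x v → IsAncestor G r y v →
    IsAncestor G r x y ∨ IsAncestor G r y x) (fun hx _ => ?_) (fun p v hp ih hx hy => ?_) v hx hy
  · exact Or.inl (hx.trans (isAncestor_root r y))
  · by_cases hxv : x = v
    · exact Or.inr (hxv ▸ hy)
    by_cases hyv : y = v
    · exact Or.inl (hyv ▸ hx)
    exact ih (hx.of_isParent hG hxv hp) (hy.of_isParent hG hyv hp)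

/-- Descend towards `a`: as long as the current vertex is an ancestor of `b` it is the meet itself,
and afterwards new edges do not separate `r` from `b`, so the meet stays the same. -/
theorem exists_isMeet (r a b : V) : ∃ c, IsMeet G r c a b := by
  refine parent_induction hG (r := r) (motive := fun a => ∃ c, IsMeet G r c a b) ?_
    (fun p v hp ih => ?_) a
  · exact ⟨r, fun e => ⟨fun h => absurd h (not_separates_self e r), fun h => h.1⟩⟩
  · by_cases hv : IsAncestor G r v b
    · exact ⟨v, fun e => ⟨fun h => ⟨h, hv e h⟩, fun h => h.1⟩⟩
    · obtain ⟨c, hc⟩ := ih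
      refine ⟨c, fun e => ?_⟩
      rw [hc e, hp.separates_iff hG e]
      constructor
      · exact fun h => ⟨Or.inl h.1, h.2⟩
      · rintro ⟨h | rfl, h'⟩
        · exact ⟨h, h'⟩
        · exact absurd ((hp.separates_iff_isAncestor hG).1 h') hv

theorem isMeet_of_isParent {r x w a b : V} (hw : IsParent G r x w) (ha : IsAncestor G r w a)
    (hb : IsAncestor G r x b) (hwb : ¬ IsAncestor G r w b) : IsMeet G r x a b := by
  obtain ⟨c, hc⟩ := exists_isMeet hG r a b
  have hxa : IsAncestor G r x a := (hw.ancestor hG).trans ha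
  have hxc := hc.ancestor hxa hb
  have hcx : IsAncestor G r c x := by
    rcases hc.ancestor_left.total hG ha with h | h
    · refine h.of_isParent hG ?_ hw
      rintro rfl
      exact hwb hc.ancestor_right
    · exact absurd (h.trans hc.ancestor_right) hwb
  rwa [hxc.antisymm hG hcx]

theorem IsMeet.unique {r c c' a b : V} (h : IsMeet G r c a b) (h' : IsMeet G r c' a b) :
    c = c' :=
  (h'.ancestor h.ancestor_left h.ancestor_right).antisymm hG
    (h.ancestor h'.ancestor_left h'.ancestor_right)

theorem induce_reachable_of_isAncestor {r : V} {A : Set V}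
    (hA : ∀ x y, IsAncestor G r x y → x ∈ A → y ∈ A) {c v : V} (hc : c ∈ A)
    (h : IsAncestor G r c v) :
    (G.induce A).Reachable ⟨c, hc⟩ ⟨v, hA c v h hc⟩ := by
  refine parent_induction hG (r := r) (motive := fun v => ∀ h : IsAncestor G r c v,
    (G.induce A).Reachable ⟨c, hc⟩ ⟨v, hA c v h hc⟩) (fun h => ?_) (fun p v hp ih h => ?_) v h
  · have : c = r := h.antisymm hG (isAncestor_root r c)
    subst this
    exact SimpleGraph.Reachable.refl _
  · by_cases hcv : c = v
    · subst hcv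
      exact SimpleGraph.Reachable.refl _
    · have hcp := h.of_isParent hG hcv hp
      refine (ih hcp).trans (SimpleGraph.Adj.reachable ?_)
      exact hp.1

theorem exists_top_ancestor (r : V) (A : Set V) {u : V} (hu : u ∈ A) :
    ∃ c ∈ A, IsAncestor G r c u ∧ ∀ p, IsParent G r p c → p ∉ A := by
  refine parent_induction hG (r := r) (motive := fun u => u ∈ A →
    ∃ c ∈ A, IsAncestor G r c u ∧ ∀ p, IsParent G r p c → p ∉ A)
    (fun hu => ?_) (fun p v hp ih hv => ?_) u hu
  · exact ⟨r, hu, IsAncestor.refl r r, fun p hp => absurd rfl (hp.ne_root hG)⟩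
  · by_cases hpA : p ∈ A
    · obtain ⟨c, hc, hcp, htop⟩ := ih hpA
      exact ⟨c, hc, hcp.trans (hp.ancestor hG), htop⟩
    · exact ⟨v, hv, IsAncestor.refl r v, fun q hq => (hq.unique hG hp) ▸ hpA⟩

/-- The subtree below `c` can only be left through the parent of `c`, which is not in `A`. -/
theorem isAncestor_of_induce_reachable {r : V} {A : Set V} {c : V}
    (htop : ∀ p, IsParent G r p c → p ∉ A) {u v : A} (h : (G.induce A).Reachable u v)
    (hu : IsAncestor G r c u) : IsAncestor G r c v := by
  obtain ⟨p⟩ := h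
  induction p with
  | nil => exact hu
  | @cons u w z hadj q ih =>
    refine ih ?_
    have hadj : G.Adj u w := hadj
    rcases isParent_or_isParent hG r hadj with h | h
    · exact hu.trans (h.ancestor hG)
    · refine hu.of_isParent hG ?_ h
      rintro rfl
      exact htop _ h w.2

/-- The components of a set closed under descendants are the full subtrees below its top vertices. A
common top vertex of `a` and `b` is an ancestor of their meet. -/
theorem induce_reachable_iff {r : V} {A : Set V}
    (hA : ∀ x y, IsAncestor G r x y → x ∈ A → y ∈ A) {a b c : V} (hc : IsMeet G r c a b) :
    (∃ (ha : a ∈ A) (hb : b ∈ A), (G.induce A).Reachable ⟨a, ha⟩ ⟨b, hb⟩) ↔ c ∈ A := by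
  constructor
  · rintro ⟨ha, hb, h⟩
    obtain ⟨d, hd, hda, htop⟩ := exists_top_ancestor hG r A ha
    have hdb := isAncestor_of_induce_reachable hG htop h hda
    exact hA _ _ (hc.ancestor hda hdb) hd
  · intro h
    exact ⟨hA _ _ hc.ancestor_left h, hA _ _ hc.ancestor_right h,
      (induce_reachable_of_isAncestor hG hA h hc.ancestor_left).symm.trans
        (induce_reachable_of_isAncestor hG hA h hc.ancestor_right)⟩

end RootedTrees

/-! ### Distances in a combinatorial type -/

namespace CombType

section Dist

variable {n : ℕ} (T : CombType n)

theorem onPath_iff {u v : T.V} {e : T.Edge} : T.OnPath u v e ↔ Separates T.graph e u v :=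
  exists_isPath_mem_edges_iff T.isTree

open Classical in
theorem dist_apply (u v : T.V) (l : T.Edge → ℝ) :
    T.dist u v l = ∑ e : T.Edge, if Separates T.graph e u v then l e else 0 := by
  rw [dist, LinearMap.sum_apply]
  refine Finset.sum_congr rfl fun e _ => ?_
  by_cases h : Separates T.graph e u v
  · rw [if_pos h, if_pos (T.onPath_iff.2 h), LinearMap.proj_apply]
  · rw [if_neg h, if_neg (fun h' => h (T.onPath_iff.1 h')), LinearMap.zero_apply]

/-- The Gromov product is the distance from the root to the meet. -/
theorem dist_add_dist_sub_dist {r a b c : T.V} (hc : IsMeet T.graph r c a b) (l : T.Edge → ℝ) :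
    T.dist r a l + T.dist r b l - T.dist a b l = 2 * T.dist r c l := by
  classical
  simp only [dist_apply]
  rw [← Finset.sum_add_distrib, ← Finset.sum_sub_distrib, Finset.mul_sum]
  -- Compare edge by edge: an edge contributes `2` if it separates `r` from both `a` and `b`;
  -- otherwise its contributions cancel.
  refine Finset.sum_congr rfl fun e _ => ?_
  have h1 := separates_iff_not_iff T.isTree e.2 r a b
  have h2 := hc e
  by_cases ha : Separates T.graph e r a <;> by_cases hb : Separates T.graph e r b <;>
    simp [ha, hb] at h1 h2 <;> simp [h1, h2, ha, hb]
  ring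

end Dist

variable {m : ℕ} (T : CombType (m + 1))

theorem rootDist_root (l : T.Edge → ℝ) : T.rootDist T.root l = 0 := by
  rw [rootDist, dist_apply]
  exact Finset.sum_eq_zero fun e _ => if_neg (not_separates_self _ _)

theorem rootDist_of_isParent {p v : T.V} (h : IsParent T.graph T.root p v) (l : T.Edge → ℝ) :
    T.rootDist v l = T.rootDist p l + l ⟨s(p, v), h.1⟩ := by
  classical
  have hs : l ⟨s(p, v), h.1⟩ = ∑ e : T.Edge, if e = ⟨s(p, v), h.1⟩ then l e else 0 := by simp
  rw [rootDist, rootDist, dist_apply, dist_apply, hs, ← Finset.sum_add_distrib]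
  refine Finset.sum_congr rfl fun e _ => ?_
  have h1 := h.separates_iff T.isTree e
  by_cases he : e = ⟨s(p, v), h.1⟩
  · subst he
    simp [h.separates T.isTree, h.2]
  · have he' : (e : Sym2 T.V) ≠ s(p, v) := fun h' => he (Subtype.ext h')
    simp only [he', or_false] at h1
    simp [h1, he]

theorem rootDist_mono {x y : T.V} (h : IsAncestor T.graph T.root x y) {l : T.Edge → ℝ}
    (hl : ∀ e, 0 ≤ l e) : T.rootDist x l ≤ T.rootDist y l := by
  rw [rootDist, rootDist, dist_apply, dist_apply]
  refine Finset.sum_le_sum fun e _ => ?_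
  have := h e
  have := hl e
  split_ifs <;> tauto

theorem rootDist_pos {v : T.V} (hv : v ≠ T.root) {l : T.Edge → ℝ} (hl : ∀ e, 0 < l e) :
    0 < T.rootDist v l := by
  obtain ⟨p, hp⟩ := exists_isParent T.isTree hv
  rw [T.rootDist_of_isParent hp]
  have := T.rootDist_mono (isAncestor_root T.root p) (fun e => (hl e).le)
  rw [rootDist_root] at this
  exact add_pos_of_nonneg_of_pos this (hl _)

theorem exists_isParent_of_edge (e : T.Edge) :
    ∃ q : T.V × T.V, IsParent T.graph T.root q.1 q.2 ∧ (e : Sym2 T.V) = s(q.1, q.2) := by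
  obtain ⟨e, he⟩ := e
  induction e with
  | _ a b =>
  rcases isParent_or_isParent T.isTree T.root he with h | h
  · exact ⟨(a, b), h, rfl⟩
  · exact ⟨(b, a), h, Sym2.eq_swap⟩

/-- The edge lengths for which the vertices have the given distances from the root. -/
def increment : (T.V → ℝ) →ₗ[ℝ] (T.Edge → ℝ) where
  toFun t e := t (T.exists_isParent_of_edge e).choose.2 - t (T.exists_isParent_of_edge e).choose.1
  map_add' s t := by ext e; simp; ring
  map_smul' a t := by ext e; simp; ring

theorem increment_apply (t : T.V → ℝ) {p v : T.V} (h : IsParent T.graph T.root p v) :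
    T.increment t ⟨s(p, v), h.1⟩ = t v - t p := by
  obtain ⟨h1, h2⟩ := (T.exists_isParent_of_edge ⟨s(p, v), h.1⟩).choose_spec
  change t _ - t _ = _
  rcases Sym2.eq_iff.1 h2 with ⟨h3, h4⟩ | ⟨h3, h4⟩
  · rw [← h3, ← h4]
  · rw [← h3, ← h4] at h1
    exact absurd h1 (h.asymm T.isTree)

theorem rootDist_increment {t : T.V → ℝ} (ht : t T.root = 0) (v : T.V) :
    T.rootDist v (T.increment t) = t v := by
  refine parent_induction T.isTree (r := T.root)
    (motive := fun v => T.rootDist v (T.increment t) = t v) ?_ (fun p v hp ih => ?_) v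
  · rw [rootDist_root, ht]
  · rw [T.rootDist_of_isParent hp, ih, T.increment_apply t hp]
    ring

theorem forall_edge {P : T.Edge → Prop}
    (h : ∀ p v (hp : IsParent T.graph T.root p v), P ⟨s(p, v), hp.1⟩) (e : T.Edge) : P e := by
  obtain ⟨⟨p, v⟩, hp, he⟩ := T.exists_isParent_of_edge e
  have : e = ⟨s(p, v), hp.1⟩ := Subtype.ext he
  exact this ▸ h p v hp

/-! ### Every vertex is a meet of two ends -/

/-- A deepest descendant of `x` has no children, hence at most one bounded edge. By stability it
carries at least two ends, one of which is not the end `0`. -/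
theorem exists_mark_of_ancestor (x : T.V) :
    ∃ a : Fin m, IsAncestor T.graph T.root x (T.mark a.succ) := by
  obtain ⟨y, hy, hmax⟩ := Set.exists_max_image {y | IsAncestor T.graph T.root x y}
    (fun y => {e : Sym2 T.V | Separates T.graph e T.root y}.ncard) (Set.toFinite _)
    ⟨x, IsAncestor.refl _ x⟩
  have hchild : ∀ w, ¬ IsParent T.graph T.root y w := by
    intro w hw
    refine absurd (hmax w (IsAncestor.trans hy (hw.ancestor T.isTree))) (not_le.2 ?_)
    refine Set.ncard_lt_ncard ⟨hw.ancestor T.isTree, fun hsub => ?_⟩ (Set.toFinite _)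
    exact hw.2 (hsub (hw.separates T.isTree))
  have hN : (T.graph.neighborSet y).ncard ≤ 1 := by
    rw [Set.ncard_le_one (Set.toFinite _)]
    intro a ha b hb
    have ha' := (isParent_or_isParent T.isTree T.root ha).resolve_left (hchild a)
    have hb' := (isParent_or_isParent T.isTree T.root hb).resolve_left (hchild b)
    exact ha'.unique T.isTree hb'
  have hM : 1 < (T.mark ⁻¹' {y}).ncard := by
    have := T.stable y
    omega
  obtain ⟨i, hi, hi0⟩ := Set.exists_ne_of_one_lt_ncard hM 0
  obtain ⟨a, rfl⟩ := Fin.exists_succ_eq.2 hi0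
  have hi : T.mark a.succ = y := hi
  exact ⟨a, hi ▸ hy⟩

/-- Of the at least three directions at `x`, exactly one points to the root: the parent, or the end
`0` if `x` is the root. -/
theorem two_le_children_add_marks (x : T.V) :
    2 ≤ {w | IsParent T.graph T.root x w}.ncard + {a : Fin m | T.mark a.succ = x}.ncard := by
  have hst := T.stable x
  have hM : (Fin.succ '' {a : Fin m | T.mark a.succ = x}).ncard =
      {a : Fin m | T.mark a.succ = x}.ncard :=
    Set.ncard_image_of_injective _ (Fin.succ_injective m)
  by_cases hx : x = T.root
  · have h1 : (T.graph.neighborSet x).ncard ≤ {w | IsParent T.graph T.root x w}.ncard := by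
      refine Set.ncard_le_ncard (fun w hw => ?_) (Set.toFinite _)
      exact (isParent_or_isParent T.isTree T.root hw).resolve_right
        fun h => h.ne_root T.isTree hx
    have h2 : (T.mark ⁻¹' {x}).ncard ≤
        (insert 0 (Fin.succ '' {a : Fin m | T.mark a.succ = x})).ncard := by
      refine Set.ncard_le_ncard (fun i hi => ?_) (Set.toFinite _)
      rcases Fin.eq_zero_or_eq_succ i with rfl | ⟨a, rfl⟩
      · exact Set.mem_insert _ _
      · exact Set.mem_insert_of_mem _ ⟨a, hi, rfl⟩
    have h3 := Set.ncard_insert_le (0 : Fin (m + 1)) (Fin.succ '' {a : Fin m | T.mark a.succ = x})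
    omega
  · obtain ⟨p, hp⟩ := exists_isParent T.isTree hx
    have h1 : (T.graph.neighborSet x).ncard ≤
        (insert p {w | IsParent T.graph T.root x w}).ncard := by
      refine Set.ncard_le_ncard (fun w hw => ?_) (Set.toFinite _)
      rcases isParent_or_isParent T.isTree T.root hw with h | h
      · exact Set.mem_insert_of_mem _ h
      · exact (h.unique T.isTree hp) ▸ Set.mem_insert _ _
    have h2 : (T.mark ⁻¹' {x}).ncard ≤ (Fin.succ '' {a : Fin m | T.mark a.succ = x}).ncard := by
      refine Set.ncard_le_ncard (fun i hi => ?_) (Set.toFinite _)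
      rcases Fin.eq_zero_or_eq_succ i with rfl | ⟨a, rfl⟩
      · have hi : T.mark 0 = x := hi
        exact absurd hi.symm hx
      · exact ⟨a, hi, rfl⟩
    have h3 := Set.ncard_insert_le p {w | IsParent T.graph T.root x w}
    omega

/-- Two different directions away from the root lead to two ends, and the paths to these ends part
at `x`. The cases are two ends at `x`, an end and a child, or two children. -/
theorem exists_isMeet_marks (x : T.V) : ∃ a b : Fin m, a ≠ b ∧
    IsMeet T.graph T.root x (T.mark a.succ) (T.mark b.succ) := by
  have h2 := T.two_le_children_add_marks x
  by_cases hM : 1 < {a : Fin m | T.mark a.succ = x}.ncard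
  · obtain ⟨a, ha, b, hb, hab⟩ := (Set.one_lt_ncard (Set.toFinite _)).1 hM
    have ha : T.mark a.succ = x := ha
    have hb : T.mark b.succ = x := hb
    exact ⟨a, b, hab, fun e => by rw [ha, hb, and_self]⟩
  have key : ∀ w (b : Fin m), IsParent T.graph T.root x w →
      IsAncestor T.graph T.root x (T.mark b.succ) →
      ¬ IsAncestor T.graph T.root w (T.mark b.succ) → ∃ a b : Fin m, a ≠ b ∧
      IsMeet T.graph T.root x (T.mark a.succ) (T.mark b.succ) := by
    intro w b hw hb hwb
    obtain ⟨a, ha⟩ := T.exists_mark_of_ancestor w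
    refine ⟨a, b, ?_, isMeet_of_isParent T.isTree hw ha hb hwb⟩
    rintro rfl
    exact hwb ha
  by_cases hM' : {a : Fin m | T.mark a.succ = x}.Nonempty
  · obtain ⟨b, hb⟩ := hM'
    have hb : T.mark b.succ = x := hb
    have hC : {w | IsParent T.graph T.root x w}.Nonempty :=
      Set.nonempty_of_ncard_ne_zero (by omega)
    obtain ⟨w, hw⟩ := hC
    exact key w b hw (hb ▸ IsAncestor.refl _ _) (hb ▸ hw.not_isAncestor T.isTree)
  · have h0 : {a : Fin m | T.mark a.succ = x}.ncard = 0 := by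
      rw [Set.not_nonempty_iff_eq_empty.1 hM', Set.ncard_empty]
    obtain ⟨w, hw, w', hw', hne⟩ := (Set.one_lt_ncard (Set.toFinite _)).1
      (show 1 < {w | IsParent T.graph T.root x w}.ncard by omega)
    have hw : IsParent T.graph T.root x w := hw
    have hw' : IsParent T.graph T.root x w' := hw'
    obtain ⟨b, hb⟩ := T.exists_mark_of_ancestor w'
    refine key w b hw ((hw'.ancestor T.isTree).trans hb) fun hwb => ?_
    rcases hwb.total T.isTree hb with h | h
    · exact hw.not_isAncestor T.isTree (h.of_isParent T.isTree hne hw')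
    · exact hw'.not_isAncestor T.isTree (h.of_isParent T.isTree hne.symm hw)

/-- The last common vertex of the paths from the root to two ends. -/
def meet (a b : Fin m) : T.V :=
  (exists_isMeet T.isTree T.root (T.mark a.succ) (T.mark b.succ)).choose

theorem isMeet_meet (a b : Fin m) :
    IsMeet T.graph T.root (T.meet a b) (T.mark a.succ) (T.mark b.succ) :=
  (exists_isMeet T.isTree T.root (T.mark a.succ) (T.mark b.succ)).choose_spec

theorem meet_comm (a b : Fin m) : T.meet a b = T.meet b a :=
  (T.isMeet_meet a b).unique T.isTree fun e => by rw [T.isMeet_meet b a e, and_comm]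

theorem exists_meet_eq (x : T.V) : ∃ a b : Fin m, a ≠ b ∧ T.meet a b = x := by
  obtain ⟨a, b, hab, h⟩ := T.exists_isMeet_marks x
  exact ⟨a, b, hab, (T.isMeet_meet a b).unique T.isTree h⟩

end CombType

/-! ### Level flats -/

namespace RadialType

variable {m : ℕ} (C : RadialType m)

theorem le_of_isAncestor {x y : C.V} (h : IsAncestor C.graph C.root x y) : C.le x y := by
  obtain ⟨l, hl, hle⟩ := C.aligned
  rw [hle]
  exact C.rootDist_mono h fun e => (hl e).le

theorem le_total (x y : C.V) : C.le x y ∨ C.le y x := by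
  obtain ⟨l, hl, hle⟩ := C.aligned
  rw [hle, hle]
  exact _root_.le_total _ _

theorem le_trans {x y z : C.V} (h : C.le x y) (h' : C.le y z) : C.le x z := by
  obtain ⟨l, hl, hle⟩ := C.aligned
  rw [hle] at *
  exact h.trans h'

theorem not_le_root {x : C.V} (hx : x ≠ C.root) : ¬ C.le x C.root := by
  obtain ⟨l, hl, hle⟩ := C.aligned
  rw [hle, C.rootDist_root]
  exact not_le.2 (C.rootDist_pos hx hl)

theorem mem_levelFlat_iff {u : C.V} {a b : Fin m} :
    s(a, b) ∈ C.levelFlat u ↔ a ≠ b ∧ C.le u (C.meet a b) := by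
  have key : ∀ a b : Fin m, (∃ (ha : C.le u (C.mark a.succ)) (hb : C.le u (C.mark b.succ)),
      (C.graph.induce {v | C.le u v}).Reachable ⟨C.mark a.succ, ha⟩ ⟨C.mark b.succ, hb⟩) ↔
      C.le u (C.meet a b) := fun a b =>
    induce_reachable_iff C.isTree (A := {v | C.le u v})
      (fun x y hxy hx => C.le_trans hx (C.le_of_isAncestor hxy)) (C.isMeet_meet a b)
  constructor
  · rintro ⟨a', b', hne, he, h⟩
    rcases Sym2.eq_iff.1 he with ⟨rfl, rfl⟩ | ⟨rfl, rfl⟩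
    · exact ⟨hne, (key _ _).1 h⟩
    · rw [C.meet_comm]
      exact ⟨hne.symm, (key _ _).1 h⟩
  · rintro ⟨hne, h⟩
    exact ⟨a, b, hne, rfl, (key a b).2 h⟩

theorem levelFlat_anti {u v : C.V} (h : C.le u v) : C.levelFlat v ⊆ C.levelFlat u := by
  intro e
  induction e with
  | _ a b =>
  rw [mem_levelFlat_iff, mem_levelFlat_iff]
  exact fun h' => ⟨h'.1, C.le_trans h h'.2⟩

/-- The meets of `a, b` and of `b, c` are both ancestors of `b`, hence comparable. The one closer to
the root is an ancestor of both `a` and `c`, so of their meet. -/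
theorem isFlat_levelFlat (u : C.V) : (matroidK m).IsFlat (C.levelFlat u) := by
  rw [isFlat_cycleMatroid_top_iff]
  constructor
  · rintro _ ⟨a, b, hab, rfl, -⟩
    simpa using hab
  · intro a b c hab hbc hac
    rw [mem_levelFlat_iff] at *
    refine ⟨hac, ?_⟩
    rcases (C.isMeet_meet a b).ancestor_right.total C.isTree
      (C.isMeet_meet b c).ancestor_left with h | h
    · exact C.le_trans hab.2 (C.le_of_isAncestor ((C.isMeet_meet a c).ancestor
        (C.isMeet_meet a b).ancestor_left (h.trans (C.isMeet_meet b c).ancestor_right)))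
    · exact C.le_trans hbc.2 (C.le_of_isAncestor ((C.isMeet_meet a c).ancestor
        (h.trans (C.isMeet_meet a b).ancestor_left) (C.isMeet_meet b c).ancestor_right))

/-- Nonemptiness and properness use that vertices are meets: a pair meeting at `u` belongs to the
flat, a pair meeting at the root does not. -/
theorem isChainOfFlats_levelChain : IsChainOfFlats (matroidK m) C.levelChain := by
  constructor
  · rintro _ ⟨u, -, rfl⟩ _ ⟨v, -, rfl⟩ -
    rcases C.le_total u v with h | h
    · exact Or.inr (C.levelFlat_anti h)
    · exact Or.inl (C.levelFlat_anti h)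
  · rintro _ ⟨u, hu, rfl⟩
    refine ⟨C.isFlat_levelFlat u, ?_, fun hE => ?_⟩
    · obtain ⟨a, b, hab, hu'⟩ := C.exists_meet_eq u
      exact ⟨s(a, b), C.mem_levelFlat_iff.2 ⟨hab, hu' ▸ C.le_of_isAncestor (IsAncestor.refl _ _)⟩⟩
    · obtain ⟨a, b, hab, hr⟩ := C.exists_meet_eq C.root
      have : s(a, b) ∈ C.levelFlat u := by
        rw [hE]
        exact mk_mem_ground_cycleMatroid_top.2 hab
      rw [mem_levelFlat_iff, hr] at this
      exact C.not_le_root hu this.2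

/-- The distances from the root of the curves of a radially aligned type, as functions on the
vertices. -/
theorem map_lengths_rootDist :
    C.lengths.map (LinearMap.pi C.rootDist) =
      indicatorCone ((fun u => {v | C.le u v}) '' {u | u ≠ C.root}) := by
  classical
  have h𝓖 : IsChain (· ⊆ ·) ((fun u => {v | C.le u v}) '' {u | u ≠ C.root}) := by
    rintro _ ⟨u, -, rfl⟩ _ ⟨v, -, rfl⟩ -
    rcases C.le_total u v with h | h
    · exact Or.inr fun w hw => C.le_trans h hw
    · exact Or.inl fun w hw => C.le_trans h hw
  apply le_antisymm
  · rintro _ ⟨l, ⟨hl, hle⟩, rfl⟩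
    refine mem_indicatorCone_of_superlevelIn ⟨fun v => ?_, fun t ht => ?_⟩
    · change 0 ≤ C.rootDist v l
      rw [← C.rootDist_root l]
      exact C.rootDist_mono (isAncestor_root _ v) hl
    · change {v | t ≤ C.rootDist v l} = ∅ ∨ {v | t ≤ C.rootDist v l} ∈ _
      rcases Set.eq_empty_or_nonempty {v | t ≤ C.rootDist v l} with h | h
      · exact Or.inl h
      right
      -- The given `l` may identify levels that the alignment distinguishes, so the lowest vertex of
      -- the superlevel set is chosen with respect to lengths that realize the alignment.
      obtain ⟨l₀, hl₀, hle₀⟩ := C.aligned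
      obtain ⟨u, hu, hmin⟩ := exists_min_of_nonempty (fun v => C.rootDist v l₀) h
      have hu : t ≤ C.rootDist u l := hu
      refine ⟨u, ?_, ?_⟩
      · rintro rfl
        rw [C.rootDist_root] at hu
        exact absurd ht (not_lt.2 hu)
      · ext v
        constructor
        · intro hv
          exact hu.trans (hle u v hv)
        · intro hv
          exact (hle₀ u v).2 (hmin v hv)
  · refine Submodule.span_le.2 ?_
    rintro _ ⟨_, ⟨u, hu, rfl⟩, rfl⟩
    have h0 : ({v | C.le u v}.indicator (1 : C.V → ℝ)) C.root = 0 :=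
      Set.indicator_of_notMem (C.not_le_root hu) _
    have hmono : ∀ v w, C.le v w → ({v | C.le u v}.indicator (1 : C.V → ℝ)) v ≤
        ({v | C.le u v}.indicator (1 : C.V → ℝ)) w := by
      intro v w hvw
      by_cases hv : C.le u v
      · rw [Set.indicator_of_mem (show v ∈ {v | C.le u v} from hv),
          Set.indicator_of_mem (show w ∈ {v | C.le u v} from C.le_trans hv hvw)]
        rfl
      · rw [Set.indicator_of_notMem (show v ∉ {v | C.le u v} from hv)]
        exact Set.indicator_nonneg (fun _ _ => zero_le_one) w
    -- Edges that enter the upper set of `u` get length `1`, all others length `0`.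
    refine ⟨C.increment ({v | C.le u v}.indicator 1), ⟨?_, fun v w hvw => ?_⟩, ?_⟩
    · refine C.forall_edge fun p v hp => ?_
      rw [C.increment_apply _ hp]
      exact sub_nonneg.2 (hmono _ _ (C.le_of_isAncestor (hp.ancestor C.isTree)))
    · rw [C.rootDist_increment h0, C.rootDist_increment h0]
      exact hmono v w hvw
    · ext v
      exact C.rootDist_increment h0 v

end RadialType

/-! ### The isomorphism -/

section Gromov

/-- The coordinate of the unordered pair `{i, j}`, and `0` if `i = j`. -/
def pairCoord {n : ℕ} (i j : Fin n) : (Pairs n → ℝ) →ₗ[ℝ] ℝ :=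
  if h : i < j then LinearMap.proj (⟨(i, j), h⟩ : Pairs n)
  else if h : j < i then LinearMap.proj (⟨(j, i), h⟩ : Pairs n) else 0

theorem pairCoord_of_lt {n : ℕ} {i j : Fin n} (h : i < j) (d : Pairs n → ℝ) :
    pairCoord i j d = d ⟨(i, j), h⟩ := by
  rw [pairCoord, dif_pos h, LinearMap.proj_apply]

theorem pairCoord_comm {n : ℕ} (i j : Fin n) : pairCoord i j = pairCoord j i := by
  rcases lt_trichotomy i j with h | rfl | h
  · rw [pairCoord, pairCoord, dif_pos h, dif_neg h.asymm, dif_pos h]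
  · rfl
  · rw [pairCoord, pairCoord, dif_pos h, dif_neg h.asymm, dif_pos h]

theorem pairCoord_eq {n : ℕ} (f : Fin n → Fin n → ℝ) (hf : ∀ i j, f i j = f j i) {i j : Fin n}
    (h : i ≠ j) : pairCoord i j (fun p => f p.1.1 p.1.2) = f i j := by
  rcases h.lt_or_gt with h | h
  · rw [pairCoord_of_lt h]
  · rw [pairCoord_comm, pairCoord_of_lt h, hf]

variable (m : ℕ)

/-- The negative Gromov products with respect to the end `0`. -/
def gromov : (Pairs (m + 1) → ℝ) →ₗ[ℝ] ((matroidK m).E → ℝ) :=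
  LinearMap.pi fun e => Sym2.lift ⟨fun a b : Fin m => (2⁻¹ : ℝ) •
    (pairCoord a.succ b.succ - pairCoord 0 a.succ - pairCoord 0 b.succ), fun a b => by
      dsimp only
      rw [pairCoord_comm, sub_right_comm]⟩ (e : Sym2 (Fin m))

variable {m}

theorem gromov_apply (d : Pairs (m + 1) → ℝ) {a b : Fin m} (h : s(a, b) ∈ (matroidK m).E) :
    gromov m d ⟨s(a, b), h⟩ =
      (pairCoord a.succ b.succ d - pairCoord 0 a.succ d - pairCoord 0 b.succ d) / 2 := by
  change (2⁻¹ : ℝ) * (pairCoord a.succ b.succ d - pairCoord 0 a.succ d - pairCoord 0 b.succ d) = _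
  ring

theorem mk_mem_ground {a b : Fin m} : s(a, b) ∈ (matroidK m).E ↔ a ≠ b :=
  mk_mem_ground_cycleMatroid_top

theorem ground_induction {P : (matroidK m).E → Prop}
    (h : ∀ (a b : Fin m) (hab : a ≠ b), P ⟨s(a, b), mk_mem_ground.2 hab⟩)
    (e : (matroidK m).E) : P e := by
  obtain ⟨e, he⟩ := e
  induction e with
  | _ a b => exact h a b (mk_mem_ground.1 he)

theorem mem_lineality_iff {α : Type*} {M : Matroid α} {w : M.E → ℝ} :
    w ∈ lineality M ↔ ∃ c : ℝ, ∀ e, w e = c := by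
  rw [lineality, Submodule.mem_span_singleton]
  constructor
  · rintro ⟨c, rfl⟩
    exact ⟨c, fun e => by simp⟩
  · rintro ⟨c, hc⟩
    exact ⟨c, by ext e; simp [hc]⟩

theorem gromov_mem_lineality_iff {d : Pairs (m + 1) → ℝ} :
    gromov m d ∈ lineality (matroidK m) ↔ d ∈ LinearMap.range (Phi (m + 1)) := by
  rw [mem_lineality_iff]
  constructor
  · rintro ⟨c, hc⟩
    -- The equations `d(a,b) = d(0,a) + d(0,b) + 2c` and `d(0,a) = x 0 + x a` are solved by `x 0 =
    -- -c` and `x a = d(0,a) + c`.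
    refine ⟨Fin.cons (-c) fun a => pairCoord 0 a.succ d + c, ?_⟩
    ext ⟨⟨i, j⟩, hij⟩
    rcases Fin.eq_zero_or_eq_succ j with rfl | ⟨b, rfl⟩
    · exact absurd hij (Fin.not_lt_zero i)
    rcases Fin.eq_zero_or_eq_succ i with rfl | ⟨a, rfl⟩
    · rw [← pairCoord_of_lt hij d]
      simp [Phi]
    · have hab : a ≠ b := by
        rintro rfl
        exact lt_irrefl _ hij
      have := hc ⟨s(a, b), mk_mem_ground.2 hab⟩
      rw [gromov_apply] at this
      rw [← pairCoord_of_lt hij d]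
      simp only [Phi, LinearMap.coe_mk, AddHom.coe_mk, Fin.cons_succ]
      linarith
  · rintro ⟨x, rfl⟩
    refine ⟨-x 0, ground_induction fun a b hab => ?_⟩
    have h1 : ∀ i j, i ≠ j → pairCoord i j (Phi (m + 1) x) = x i + x j := fun i j hij =>
      pairCoord_eq (fun i j => x i + x j) (fun i j => add_comm _ _) hij
    rw [gromov_apply, h1 _ _ (by simpa using hab), h1 _ _ (Fin.succ_ne_zero a).symm,
      h1 _ _ (Fin.succ_ne_zero b).symm]
    ring

theorem gromov_surjective : Function.Surjective (gromov m) := by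
  intro w
  classical
  -- The preimage puts the end `0` at distance `0` from all other ends and uses `2w` on the
  -- remaining pairs.
  let f : Fin (m + 1) → Fin (m + 1) → ℝ := fun i j =>
    Fin.cases 0 (fun a => Fin.cases 0 (fun b =>
      if h : a ≠ b then 2 * w ⟨s(a, b), mk_mem_ground.2 h⟩ else 0) j) i
  have hf : ∀ i j, f i j = f j i := by
    intro i j
    rcases Fin.eq_zero_or_eq_succ i with rfl | ⟨a, rfl⟩ <;>
      rcases Fin.eq_zero_or_eq_succ j with rfl | ⟨b, rfl⟩
    · rfl
    · rfl
    · rfl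
    · change dite _ _ _ = dite _ _ _
      by_cases h : a = b
      · subst h; rfl
      · rw [dif_pos h, dif_pos (Ne.symm h)]
        simp only [Sym2.eq_swap]
  refine ⟨fun p => f p.1.1 p.1.2, ?_⟩
  ext e
  refine ground_induction (P := fun e => gromov m (fun p => f p.1.1 p.1.2) e = w e)
    (fun a b hab => ?_) e
  rw [gromov_apply, pairCoord_eq f hf (by simpa using hab),
    pairCoord_eq f hf (Fin.succ_ne_zero a).symm, pairCoord_eq f hf (Fin.succ_ne_zero b).symm]
  change (dite _ _ _ - 0 - 0) / 2 = _
  rw [dif_pos hab]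
  ring

variable (m)

theorem ker_mkQ_comp_gromov :
    LinearMap.ker ((lineality (matroidK m)).mkQ ∘ₗ gromov m) = LinearMap.range (Phi (m + 1)) := by
  ext d
  rw [LinearMap.mem_ker, LinearMap.comp_apply, Submodule.mkQ_apply,
    Submodule.Quotient.mk_eq_zero, gromov_mem_lineality_iff]

/-- The isomorphism `Q_n ≅ ℝ^{|E(K_{n-1})|} / L` given by the negative Gromov products. -/
def psi : Q (m + 1) ≃ₗ[ℝ] BergmanSpace (matroidK m) :=
  (Submodule.quotEquivOfEq _ _ (ker_mkQ_comp_gromov m).symm).trans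
    (((lineality (matroidK m)).mkQ ∘ₗ gromov m).quotKerEquivOfSurjective
      ((Submodule.mkQ_surjective _).comp gromov_surjective))

variable {m}

theorem psi_mkQ (d : Pairs (m + 1) → ℝ) :
    psi m ((LinearMap.range (Phi (m + 1))).mkQ d) = (lineality (matroidK m)).mkQ (gromov m d) :=
  rfl

end Gromov

/-! ### The isomorphism on vectors and cones of curves -/

namespace CombType

variable {m : ℕ} (T : CombType (m + 1))

/-- The function on `E(K_{n-1})` that assigns to `ab` the value of `-t` at the meet of the ends
`a` and `b`, modulo constants. -/
def meetVec : (T.V → ℝ) →ₗ[ℝ] BergmanSpace (matroidK m) :=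
  (lineality (matroidK m)).mkQ ∘ₗ LinearMap.pi fun e =>
    -LinearMap.proj (Sym2.lift ⟨T.meet, T.meet_comm⟩ (e : Sym2 (Fin m)))

/-- By `dist_add_dist_sub_dist`, the Gromov product of two ends at the root is the height of their
meet. -/
theorem psi_curveVec (l : T.Edge → ℝ) :
    psi m (T.curveVec l) = T.meetVec (LinearMap.pi T.rootDist l) := by
  classical
  change psi m ((LinearMap.range (Phi (m + 1))).mkQ _) = (lineality (matroidK m)).mkQ _
  rw [psi_mkQ]
  congr 1
  ext e
  refine ground_induction (P := fun e => gromov m ((LinearMap.pi fun p : Pairs (m + 1) =>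
    T.dist (T.mark p.1.1) (T.mark p.1.2)) l) e =
    (LinearMap.pi fun e : (matroidK m).E =>
    -LinearMap.proj (R := ℝ) (φ := fun _ : T.V => ℝ)
      (Sym2.lift ⟨T.meet, T.meet_comm⟩ (e : Sym2 (Fin m)))) (LinearMap.pi T.rootDist l) e)
    (fun a b hab => ?_) e
  have hd : ∀ i j, i ≠ j → pairCoord i j ((LinearMap.pi fun p : Pairs (m + 1) =>
      T.dist (T.mark p.1.1) (T.mark p.1.2)) l) = T.dist (T.mark i) (T.mark j) l := fun i j hij =>
    pairCoord_eq (fun i j => T.dist (T.mark i) (T.mark j) l) (fun i j => by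
      rw [dist_apply, dist_apply]
      refine Finset.sum_congr rfl fun e _ => ?_
      exact if_congr ⟨Separates.symm, Separates.symm⟩ rfl rfl) hij
  rw [gromov_apply, hd _ _ (by simpa using hab), hd _ _ (Fin.succ_ne_zero a).symm,
    hd _ _ (Fin.succ_ne_zero b).symm]
  change _ = - T.rootDist (T.meet a b) l
  have := T.dist_add_dist_sub_dist (T.isMeet_meet a b) l
  change T.dist (T.mark 0) _ l + T.dist (T.mark 0) _ l - _ = 2 * T.rootDist _ l at this
  linarith

theorem meetVec_indicator (A : Set T.V) (F : Set (Sym2 (Fin m)))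
    (h : ∀ a b : Fin m, a ≠ b → (T.meet a b ∈ A ↔ s(a, b) ∈ F)) :
    T.meetVec (A.indicator 1) = flatRay (matroidK m) F := by
  classical
  change (lineality (matroidK m)).mkQ _ = (lineality (matroidK m)).mkQ _
  congr 1
  ext e
  revert e
  refine ground_induction fun a b hab => ?_
  change - (A.indicator (1 : T.V → ℝ) (T.meet a b)) = - (Set.indicator _ 1 _)
  congr 1
  simp only [Set.indicator_apply, h a b hab]
  rfl

theorem isParent_root_of_ncard_eq_one (hT : T.graph.edgeSet.ncard = 1) {v : T.V}
    (hv : v ≠ T.root) : IsParent T.graph T.root T.root v := by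
  obtain ⟨p, hp⟩ := exists_isParent T.isTree hv
  by_cases hpr : p = T.root
  · rwa [hpr] at hp
  obtain ⟨q, hq⟩ := exists_isParent T.isTree hpr
  obtain ⟨e, he⟩ := Set.ncard_eq_one.1 hT
  have h1 : s(p, v) ∈ T.graph.edgeSet := hp.1
  have h2 : s(q, p) ∈ T.graph.edgeSet := hq.1
  rw [he, Set.mem_singleton_iff] at h1 h2
  rcases Sym2.eq_iff.1 (h1.trans h2.symm) with ⟨-, h⟩ | ⟨-, h⟩
  · exact absurd h.symm hp.1.ne
  · rw [h] at hp
    exact absurd hp (hq.asymm T.isTree)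

theorem eq_of_ncard_eq_one (hT : T.graph.edgeSet.ncard = 1) {v w : T.V}
    (hv : v ≠ T.root) (hw : w ≠ T.root) : v = w := by
  obtain ⟨e, he⟩ := Set.ncard_eq_one.1 hT
  have h1 : s(T.root, v) ∈ T.graph.edgeSet := (T.isParent_root_of_ncard_eq_one hT hv).1
  have h2 : s(T.root, w) ∈ T.graph.edgeSet := (T.isParent_root_of_ncard_eq_one hT hw).1
  rw [he, Set.mem_singleton_iff] at h1 h2
  exact Sym2.congr_right.1 (h1.trans h2.symm)

theorem meet_ne_root_iff (hT : T.graph.edgeSet.ncard = 1) (a b : Fin m) :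
    T.meet a b ≠ T.root ↔ T.mark a.succ ≠ T.root ∧ T.mark b.succ ≠ T.root := by
  have hroot : ∀ x, IsAncestor T.graph T.root x T.root → x = T.root := fun x hx =>
    hx.antisymm T.isTree (isAncestor_root _ x)
  constructor
  · intro h
    exact ⟨fun ha => h (hroot _ (ha ▸ (T.isMeet_meet a b).ancestor_left)),
      fun hb => h (hroot _ (hb ▸ (T.isMeet_meet a b).ancestor_right))⟩
  · rintro ⟨ha, hb⟩ h
    have hab := T.eq_of_ncard_eq_one hT ha hb
    have : IsMeet T.graph T.root (T.mark a.succ) (T.mark a.succ) (T.mark b.succ) := fun e => by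
      rw [← hab, and_self]
    exact ha (((T.isMeet_meet a b).unique T.isTree this) ▸ h)

theorem psi_ray (hT : T.graph.edgeSet.ncard = 1) :
    psi m (T.curveVec fun _ => 1) = flatRay (matroidK m)
      {e | ∃ a b : Fin m, a ≠ b ∧ e = s(a, b) ∧ T.mark a.succ ≠ T.root ∧ T.mark b.succ ≠ T.root} := by
  classical
  have h : (LinearMap.pi T.rootDist fun _ => 1) = {v | v ≠ T.root}.indicator (1 : T.V → ℝ) := by
    ext v
    change T.rootDist v (fun _ => 1) = _
    by_cases hv : v = T.root
    · rw [hv, T.rootDist_root, Set.indicator_of_notMem (by simp)]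
    · rw [T.rootDist_of_isParent (T.isParent_root_of_ncard_eq_one hT hv), T.rootDist_root,
        Set.indicator_of_mem (show v ∈ {v | v ≠ T.root} from hv), zero_add, Pi.one_apply]
  rw [psi_curveVec, h]
  refine T.meetVec_indicator _ _ fun a b hab => ?_
  refine (T.meet_ne_root_iff hT a b).trans ?_
  constructor
  · exact fun h => ⟨a, b, hab, rfl, h⟩
  · rintro ⟨a', b', -, he, h⟩
    rcases Sym2.eq_iff.1 he with ⟨rfl, rfl⟩ | ⟨rfl, rfl⟩
    · exact h
    · exact h.symm

end CombType

/-- On curves of type `C`, `psi` factors through the root distances. Their cone is generated by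
indicators of upper sets, which the meet pulls back to level flats. -/
theorem RadialType.map_cone_psi {m : ℕ} (C : RadialType m) :
    C.cone.map (psi m : Q (m + 1) →ₗ[ℝ] BergmanSpace (matroidK m)) =
      flatCone (matroidK m) C.levelChain := by
  have h : (psi m : Q (m + 1) →ₗ[ℝ] BergmanSpace (matroidK m)) ∘ₗ C.curveVec =
      C.meetVec ∘ₗ LinearMap.pi C.rootDist := LinearMap.ext C.psi_curveVec
  rw [RadialType.cone, PointedCone.map_map, h, ← PointedCone.map_map, C.map_lengths_rootDist,
    indicatorCone, map_hull, flatCone, Set.image_image, Set.image_image]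
  congr 1
  ext x
  have key : ∀ u, C.meetVec ({v | C.le u v}.indicator 1) = flatRay (matroidK m) (C.levelFlat u) :=
    fun u => C.meetVec_indicator _ _ fun a b hab => by
      rw [C.mem_levelFlat_iff]
      exact ⟨fun h => ⟨hab, h⟩, fun h => h.2⟩
  constructor
  · rintro ⟨u, hu, rfl⟩
    exact ⟨_, ⟨u, hu, rfl⟩, (key u).symm⟩
  · rintro ⟨_, ⟨u, hu, rfl⟩, rfl⟩
    exact ⟨u, hu, key u⟩

/-! ### Hasse diagrams of rooted forest orders are trees -/

section HasseTree

variable {V : Type*} [PartialOrder V] (hV : ∀ v x y : V, x ≤ v → y ≤ v → x ≤ y ∨ y ≤ x)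

-- A walk entering the upper set of `v` does so along a covering `u ⋖ u'`. Elements below a common
-- bound are comparable, which forces `u' = v` and then `u = p`.
include hV in
theorem mem_edges_hasse {p v u w : V} (hpv : p ⋖ v) (hu : ¬ v ≤ u) (hw : v ≤ w)
    (q : (SimpleGraph.hasse V).Walk u w) : s(p, v) ∈ q.edges := by
  induction q with
  | nil => exact absurd hw hu
  | @cons u u' w hadj q ih =>
    rw [SimpleGraph.Walk.edges_cons, List.mem_cons]
    by_cases hu' : v ≤ u'
    · left
      have hcov : u ⋖ u' := by
        rcases hadj with h | h
        · exact h
        · exact absurd (hu'.trans h.le) hu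
      have huv : u ≤ v := (hV u' u v hcov.le hu').resolve_right hu
      have hlt : u < v := lt_of_le_not_ge huv hu
      have hv : v = u' := (hcov.eq_or_eq huv hu').resolve_left hlt.ne'
      subst hv
      have hp : p = u := by
        rcases hV v p u hpv.le huv with h | h
        · exact ((hpv.eq_or_eq h huv).resolve_right hlt.ne).symm
        · exact (hcov.eq_or_eq h hpv.le).resolve_right hpv.lt.ne
      rw [hp]
    · exact Or.inr (ih hu' hw)

variable [OrderBot V] [Finite V]

theorem exists_covBy_of_ne_bot {w : V} (hw : w ≠ ⊥) : ∃ q, q ⋖ w :=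
  exists_covBy_of_wellFoundedGT (not_isMin_iff_ne_bot.2 hw)

/-- Climb from `⊥` to `w` by coverings; the upper end of every edge used lies below `w`. -/
theorem exists_walk_hasse (w : V) : ∃ q : (SimpleGraph.hasse V).Walk ⊥ w,
    ∀ p v, p ⋖ v → ¬ v ≤ w → s(p, v) ∉ q.edges := by
  induction w using WellFoundedLT.induction with
  | _ w ih =>
  by_cases hw : w = ⊥
  · subst hw
    exact ⟨SimpleGraph.Walk.nil, by simp⟩
  obtain ⟨q, hq⟩ := exists_covBy_of_ne_bot hw
  obtain ⟨walk, hwalk⟩ := ih q hq.lt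
  have hadj : (SimpleGraph.hasse V).Adj q w := Or.inl hq
  refine ⟨walk.concat hadj, fun p v hpv hv => ?_⟩
  rw [SimpleGraph.Walk.edges_concat, List.concat_eq_append, List.mem_append, not_or]
  refine ⟨hwalk p v hpv fun h => hv (h.trans hq.le), ?_⟩
  rw [List.mem_singleton, Sym2.eq_iff]
  rintro (⟨-, rfl⟩ | ⟨-, rfl⟩)
  · exact hv le_rfl
  · exact hv hq.le

include hV

theorem isTree_hasse : (SimpleGraph.hasse V).IsTree := by
  constructor
  · rw [SimpleGraph.connected_iff_exists_forall_reachable]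
    exact ⟨⊥, fun w => ⟨(exists_walk_hasse w).choose⟩⟩
  · rw [SimpleGraph.isAcyclic_iff_forall_isBridge]
    intro e he
    induction e with
    | _ a b =>
    have key : ∀ p v : V, p ⋖ v → (SimpleGraph.hasse V).IsBridge s(p, v) := fun p v h =>
      SimpleGraph.isBridge_iff_forall_walk_mem_edges.2 fun q =>
        mem_edges_hasse hV h (not_le_of_gt h.lt) le_rfl q
    rcases he with h | h
    · exact key a b h
    · rw [Sym2.eq_swap]
      exact key b a h

theorem separates_hasse_iff {p v w : V} (hpv : p ⋖ v) :
    Separates (SimpleGraph.hasse V) s(p, v) ⊥ w ↔ v ≤ w := by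
  constructor
  · intro h
    by_contra hn
    obtain ⟨q, hq⟩ := exists_walk_hasse w
    exact hq p v hpv hn (h q)
  · intro h q
    refine mem_edges_hasse hV hpv (fun hv => ?_) h q
    exact not_lt_bot (hpv.lt.trans_le hv)

theorem isParent_hasse_iff {p v : V} : IsParent (SimpleGraph.hasse V) ⊥ p v ↔ p ⋖ v := by
  constructor
  · rintro ⟨h | h, hs⟩
    · exact h
    · rw [Sym2.eq_swap] at hs
      exact absurd ((separates_hasse_iff hV h).2 le_rfl) hs
  · intro h
    exact ⟨Or.inl h, fun hs => not_le_of_gt h.lt ((separates_hasse_iff hV h).1 hs)⟩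

theorem isAncestor_hasse_iff {x y : V} : IsAncestor (SimpleGraph.hasse V) ⊥ x y ↔ x ≤ y := by
  by_cases hx : x = ⊥
  · subst hx
    exact ⟨fun _ => bot_le, fun _ => isAncestor_root _ _⟩
  obtain ⟨q, hq⟩ := exists_covBy_of_ne_bot hx
  rw [← separates_hasse_iff hV hq,
    ((isParent_hasse_iff hV).2 hq).separates_iff_isAncestor (isTree_hasse hV)]

end HasseTree

/-! ### The radially aligned type of an ultrametric -/

/-- Levels of unordered pairs that satisfy the (reversed) ultrametric inequality. -/
structure IsLevelFun {m : ℕ} (τ : Fin m → Fin m → ℕ) : Prop where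
  symm : ∀ a b, τ a b = τ b a
  ultra : ∀ a b c, a ≠ c → min (τ a b) (τ b c) ≤ τ a c
  exists_eq_zero : ∃ a b, a ≠ b ∧ τ a b = 0

section Clusters

variable {m : ℕ}

/-- The elements that are joined to `a` at least at the level at which `b` is. -/
def ball (τ : Fin m → Fin m → ℕ) (a b : Fin m) : Set (Fin m) := {c | c = a ∨ τ a b ≤ τ a c}

/-- The balls of a level function. -/
def Cluster (τ : Fin m → Fin m → ℕ) : Type :=
  {A : Set (Fin m) // ∃ a b, a ≠ b ∧ A = ball τ a b}

namespace Cluster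

variable {τ : Fin m → Fin m → ℕ}

instance : Finite (Cluster τ) := inferInstanceAs (Finite (Subtype _))

/-- Clusters are ordered by reverse inclusion. -/
instance : PartialOrder (Cluster τ) :=
  PartialOrder.lift (fun A => OrderDual.toDual A.1) fun _ _ h => Subtype.ext h

/-- The cluster spanned by two elements. -/
def mk {a b : Fin m} (h : a ≠ b) : Cluster τ := ⟨ball τ a b, a, b, h, rfl⟩

/-- The level of a cluster. -/
def lev (A : Cluster τ) : ℕ := τ A.2.choose A.2.choose_spec.choose

theorem left_mem (a b : Fin m) : a ∈ ball τ a b := Or.inl rfl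

theorem right_mem (a b : Fin m) : b ∈ ball τ a b := Or.inr le_rfl

theorem le_of_mem_ball (h : IsLevelFun τ) {a b c d : Fin m} (hc : c ∈ ball τ a b)
    (hd : d ∈ ball τ a b) (hcd : c ≠ d) : τ a b ≤ τ c d := by
  rcases hc with rfl | hc <;> rcases hd with rfl | hd
  · exact absurd rfl hcd
  · exact hd
  · rwa [h.symm c]
  · rw [h.symm a c] at hc
    exact (le_min hc hd).trans (h.ultra c a d hcd)

theorem lev_spec (A : Cluster τ) : ∃ a b, a ≠ b ∧ A.1 = ball τ a b ∧ A.lev = τ a b :=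
  ⟨A.2.choose, A.2.choose_spec.choose, A.2.choose_spec.choose_spec.1,
    A.2.choose_spec.choose_spec.2, rfl⟩

theorem lev_le (h : IsLevelFun τ) (A : Cluster τ) {c d : Fin m} (hc : c ∈ A.1) (hd : d ∈ A.1)
    (hcd : c ≠ d) : A.lev ≤ τ c d := by
  obtain ⟨a, b, -, hA, hl⟩ := A.lev_spec
  rw [hA] at hc hd
  rw [hl]
  exact le_of_mem_ball h hc hd hcd

theorem mem_of_lev_le (h : IsLevelFun τ) (A : Cluster τ) {c d : Fin m} (hc : c ∈ A.1)
    (hl : A.lev ≤ τ c d) : d ∈ A.1 := by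
  obtain ⟨a, b, -, hA, hl'⟩ := A.lev_spec
  rw [hA] at hc ⊢
  rw [hl'] at hl
  rcases hc with rfl | hc
  · exact Or.inr hl
  · by_cases hda : d = a
    · exact Or.inl hda
    · exact Or.inr ((le_min hc hl).trans (h.ultra a c d (Ne.symm hda)))

theorem exists_lev_eq (A : Cluster τ) : ∃ a ∈ A.1, ∃ b ∈ A.1, a ≠ b ∧ τ a b = A.lev := by
  obtain ⟨a, b, hab, hA, hl⟩ := A.lev_spec
  rw [hA, hl]
  exact ⟨a, left_mem a b, b, right_mem a b, hab, rfl⟩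

theorem lev_mk (h : IsLevelFun τ) {a b : Fin m} (hab : a ≠ b) :
    (mk hab : Cluster τ).lev = τ a b := by
  apply le_antisymm
  · exact lev_le h _ (left_mem a b) (right_mem a b) hab
  · obtain ⟨c, hc, d, hd, hcd, hl⟩ := (mk hab : Cluster τ).exists_lev_eq
    rw [← hl]
    exact le_of_mem_ball h hc hd hcd

/-- Balls of an ultrametric that share a point are nested, and the one of higher level is the
smaller set, which is the larger element of the order. -/
theorem le_of_lev_le (h : IsLevelFun τ) {A B : Cluster τ} {c : Fin m} (hA : c ∈ A.1)
    (hB : c ∈ B.1) (hl : A.lev ≤ B.lev) : A ≤ B := by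
  intro d hd
  by_cases hcd : c = d
  · exact hcd ▸ hA
  · exact A.mem_of_lev_le h hA (hl.trans (B.lev_le h hB hd hcd))

theorem lev_mono (h : IsLevelFun τ) {A B : Cluster τ} (hAB : A ≤ B) : A.lev ≤ B.lev := by
  obtain ⟨a, ha, b, hb, hab, hl⟩ := B.exists_lev_eq
  rw [← hl]
  exact A.lev_le h (hAB ha) (hAB hb) hab

theorem lev_strictMono (h : IsLevelFun τ) {A B : Cluster τ} (hAB : A < B) : A.lev < B.lev := by
  refine lt_of_le_not_ge (lev_mono h hAB.le) fun hle => ?_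
  obtain ⟨a, ha, -⟩ := B.exists_lev_eq
  exact not_le_of_gt hAB (le_of_lev_le h ha (hAB.le ha) hle)

theorem chain (h : IsLevelFun τ) (C A B : Cluster τ) (hA : A ≤ C) (hB : B ≤ C) :
    A ≤ B ∨ B ≤ A := by
  obtain ⟨a, ha, -⟩ := C.exists_lev_eq
  rcases le_total A.lev B.lev with hl | hl
  · exact Or.inl (le_of_lev_le h (hA ha) (hB ha) hl)
  · exact Or.inr (le_of_lev_le h (hB ha) (hA ha) hl)

variable [hτ : Fact (IsLevelFun τ)]

instance : OrderBot (Cluster τ) where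
  bot := mk hτ.out.exists_eq_zero.choose_spec.choose_spec.1
  bot_le _ := by
    intro c _
    right
    rw [hτ.out.exists_eq_zero.choose_spec.choose_spec.2]
    exact Nat.zero_le _

theorem mem_bot (a : Fin m) : a ∈ (⊥ : Cluster τ).1 := by
  right
  rw [hτ.out.exists_eq_zero.choose_spec.choose_spec.2]
  exact Nat.zero_le _

theorem lev_bot : (⊥ : Cluster τ).lev = 0 := by
  obtain ⟨a, b, hab, h0⟩ := hτ.out.exists_eq_zero
  exact Nat.le_zero.1 (h0 ▸ lev_le hτ.out ⊥ (mem_bot a) (mem_bot b) hab)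

variable (τ) in
theorem exists_smallest (a : Fin m) :
    ∃ A : Cluster τ, ∀ B : Cluster τ, B ≤ A ↔ a ∈ B.1 := by
  obtain ⟨A, hA, hmax⟩ := Set.exists_max_image {A : Cluster τ | a ∈ A.1} lev (Set.toFinite _)
    ⟨⊥, mem_bot a⟩
  exact ⟨A, fun B => ⟨fun h => h hA, fun h => le_of_lev_le hτ.out h hA (hmax B h)⟩⟩

variable (τ) in
/-- The vertex to which an end is attached. -/
def mark : Fin (m + 1) → Cluster τ := Fin.cons ⊥ fun a => (exists_smallest τ a).choose

theorem mark_zero : mark τ 0 = ⊥ := rfl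

theorem le_mark_iff {A : Cluster τ} {a : Fin m} : A ≤ mark τ a.succ ↔ a ∈ A.1 :=
  (exists_smallest τ a).choose_spec A

/-- The first step from `A` towards the end `a`: a child cluster containing `a`, or the end itself.
The sum type lets both kinds count in the valence. -/
theorem exists_direction {A : Cluster τ} {a : Fin m} (ha : a ∈ A.1) :
    ∃ d : Cluster τ ⊕ Fin (m + 1), (∃ w, A ⋖ w ∧ a ∈ w.1 ∧ d = Sum.inl w) ∨
      (mark τ a.succ = A ∧ d = Sum.inr a.succ) := by
  rcases (le_mark_iff.2 ha).eq_or_lt with h | h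
  · exact ⟨_, Or.inr ⟨h.symm, rfl⟩⟩
  · obtain ⟨w, hw, hwa⟩ := exists_covBy_le_of_lt h
    exact ⟨_, Or.inl ⟨w, hw, le_mark_iff.1 hwa, rfl⟩⟩

/-- One direction leads to the root, by the parent or the end `0`. Two more lead to elements `a`,
`b` that realize the level of `A`; they differ, since a child containing both would have level at
most that of `A`. -/
theorem three_le_valence (A : Cluster τ) :
    3 ≤ ((SimpleGraph.hasse (Cluster τ)).neighborSet A).ncard + (mark τ ⁻¹' {A}).ncard := by
  set N := (SimpleGraph.hasse (Cluster τ)).neighborSet A with hN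
  set M := mark τ ⁻¹' {A} with hM
  have hcard : (Sum.inl '' N ∪ Sum.inr '' M : Set (Cluster τ ⊕ Fin (m + 1))).ncard =
      N.ncard + M.ncard := by
    rw [Set.ncard_union_eq (by
      rw [Set.disjoint_left]
      rintro _ ⟨x, -, rfl⟩ ⟨y, -, hy⟩
      cases hy) (Set.toFinite _) (Set.toFinite _), Set.ncard_image_of_injective _ Sum.inl_injective,
      Set.ncard_image_of_injective _ Sum.inr_injective]
  obtain ⟨a, ha, b, hb, hab, hl⟩ := A.exists_lev_eq
  obtain ⟨d, hd⟩ := exists_direction ha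
  obtain ⟨d', hd'⟩ := exists_direction hb
  obtain ⟨d₀, hd₀⟩ : ∃ d₀ : Cluster τ ⊕ Fin (m + 1), (∃ p, p ⋖ A ∧ d₀ = Sum.inl p) ∨
      (A = ⊥ ∧ d₀ = Sum.inr 0) := by
    by_cases hA : A = ⊥
    · exact ⟨_, Or.inr ⟨hA, rfl⟩⟩
    · obtain ⟨p, hp⟩ := exists_covBy_of_ne_bot hA
      exact ⟨_, Or.inl ⟨p, hp, rfl⟩⟩
  have hmem : ∀ {a : Fin m} {d : Cluster τ ⊕ Fin (m + 1)},
      (∃ w, A ⋖ w ∧ a ∈ w.1 ∧ d = Sum.inl w) ∨ (mark τ a.succ = A ∧ d = Sum.inr a.succ) →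
      d ∈ (Sum.inl '' N ∪ Sum.inr '' M : Set (Cluster τ ⊕ Fin (m + 1))) := by
    rintro a d (⟨w, hw, -, rfl⟩ | ⟨h, rfl⟩)
    · exact Or.inl ⟨w, Or.inl hw, rfl⟩
    · exact Or.inr ⟨a.succ, h, rfl⟩
  have hne₀ : ∀ {a : Fin m} {d : Cluster τ ⊕ Fin (m + 1)},
      (∃ w, A ⋖ w ∧ a ∈ w.1 ∧ d = Sum.inl w) ∨ (mark τ a.succ = A ∧ d = Sum.inr a.succ) →
      d₀ ≠ d := by
    rintro a d (⟨w, hw, -, rfl⟩ | ⟨h, rfl⟩) <;> rcases hd₀ with ⟨p, hp, rfl⟩ | ⟨-, rfl⟩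
    · intro h
      exact (hp.lt.trans hw.lt).ne (Sum.inl_injective h)
    · exact Sum.inr_ne_inl
    · exact Sum.inl_ne_inr
    · intro h
      exact Fin.succ_ne_zero a (Sum.inr_injective h).symm
  have hne : d ≠ d' := by
    rintro rfl
    rcases hd with ⟨w, hw, haw, rfl⟩ | ⟨-, rfl⟩ <;> rcases hd' with ⟨w', hw', hbw, h⟩ | ⟨-, h⟩
    · obtain rfl := Sum.inl_injective h
      have h1 := lev_le hτ.out w haw hbw hab
      have h2 := lev_strictMono hτ.out hw.lt
      omega
    · cases h
    · cases h
    · exact hab (Fin.succ_injective _ (Sum.inr_injective h))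
  rw [← hcard, ← Set.ncard_eq_three.2 ⟨d₀, d, d', hne₀ hd, hne₀ hd', hne, rfl⟩]
  refine Set.ncard_le_ncard ?_ (Set.toFinite _)
  rintro x (rfl | rfl | rfl)
  · rcases hd₀ with ⟨p, hp, rfl⟩ | ⟨rfl, rfl⟩
    · exact Or.inl ⟨p, Or.inr hp, rfl⟩
    · exact Or.inr ⟨0, mark_zero, rfl⟩
  · exact hmem hd
  · exact hmem hd'

variable (τ) in
/-- The tree of clusters. -/
def combType : CombType (m + 1) where
  V := Cluster τ
  graph := SimpleGraph.hasse (Cluster τ)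
  isTree := isTree_hasse (chain hτ.out)
  mark := mark τ
  stable := three_le_valence

theorem rootDist_combType (v : Cluster τ) :
    (combType τ).rootDist v ((combType τ).increment fun A : Cluster τ => (A.lev : ℝ)) =
      (v.lev : ℝ) :=
  (combType τ).rootDist_increment (t := fun A : Cluster τ => (A.lev : ℝ))
    (by change ((⊥ : Cluster τ).lev : ℝ) = 0; rw [lev_bot, Nat.cast_zero]) v

variable (τ) in
/-- The tree of clusters, aligned by the levels. -/
def radialType : RadialType m where
  toCombType := combType τ
  le A B := Cluster.lev (τ := τ) A ≤ Cluster.lev (τ := τ) B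
  aligned := by
    refine ⟨(combType τ).increment fun A : Cluster τ => (A.lev : ℝ),
      (combType τ).forall_edge fun p v hp => ?_, fun u v => ?_⟩
    · refine lt_of_lt_of_eq (sub_pos.2 (Nat.cast_lt.2 ?_))
        ((combType τ).increment_apply (fun A : Cluster τ => (A.lev : ℝ)) hp).symm
      exact lev_strictMono hτ.out ((isParent_hasse_iff (chain hτ.out)).1 hp).lt
    · exact Nat.cast_le.symm.trans (iff_of_eq (congrArg₂ (· ≤ ·) (rootDist_combType u).symm
        (rootDist_combType v).symm))

/-- The meet contains `a` and `b`, so its level is at most `τ a b`. Conversely, the ball spanned by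
`a` and `b` is a common ancestor of the two ends, hence of the meet. -/
theorem lev_meet {a b : Fin m} (hab : a ≠ b) :
    Cluster.lev (τ := τ) ((radialType τ).meet a b) = τ a b := by
  have hm : IsMeet (SimpleGraph.hasse (Cluster τ)) ⊥ ((radialType τ).meet a b)
    (mark τ a.succ) (mark τ b.succ) := (radialType τ).isMeet_meet a b
  have hanc := fun x y => isAncestor_hasse_iff (chain hτ.out) (x := x) (y := y)
  apply le_antisymm
  · refine lev_le hτ.out _ ?_ ?_ hab
    · exact le_mark_iff.1 ((hanc _ _).1 hm.ancestor_left)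
    · exact le_mark_iff.1 ((hanc _ _).1 hm.ancestor_right)
  · rw [← lev_mk hτ.out hab]
    refine lev_mono hτ.out ((hanc _ _).1 (hm.ancestor ((hanc _ _).2 ?_) ((hanc _ _).2 ?_)))
    · exact le_mark_iff.2 (left_mem a b)
    · exact le_mark_iff.2 (right_mem a b)

theorem mem_levelFlat_radialType {u : (radialType τ).V} {a b : Fin m} :
    s(a, b) ∈ (radialType τ).levelFlat u ↔ a ≠ b ∧ Cluster.lev (τ := τ) u ≤ τ a b := by
  rw [RadialType.mem_levelFlat_iff]
  exact and_congr_right fun hab => iff_of_eq (congrArg _ (lev_meet (τ := τ) hab))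

theorem ne_root_iff {u : (radialType τ).V} :
    u ≠ (radialType τ).root ↔ Cluster.lev (τ := τ) u ≠ 0 := by
  have h0 : Cluster.lev (τ := τ) (radialType τ).root = 0 := lev_bot
  constructor
  · intro hu hl
    refine (radialType τ).not_le_root hu ?_
    change Cluster.lev (τ := τ) u ≤ _
    rw [hl]
    exact Nat.zero_le _
  · rintro hl rfl
    exact hl h0

end Cluster

end Clusters

/-! ### Every chain of flats comes from a radially aligned type -/

section ChainOfFlats

variable {m : ℕ}

/-- The number of members of `𝓕` that contain the pair `ab`. -/
def chainLevel (𝓕 : Set (Set (Sym2 (Fin m)))) (a b : Fin m) : ℕ := {F ∈ 𝓕 | s(a, b) ∈ F}.ncard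

theorem chainLevel_le_iff {𝓕 : Set (Set (Sym2 (Fin m)))} (h : IsChain (· ⊆ ·) 𝓕)
    {a b c d : Fin m} :
    chainLevel 𝓕 a b ≤ chainLevel 𝓕 c d ↔ ∀ F ∈ 𝓕, s(a, b) ∈ F → s(c, d) ∈ F := by
  constructor
  · intro hle
    by_contra! hcon
    obtain ⟨F, hF, hab, hcd⟩ := hcon
    refine absurd hle (not_le.2 (Set.ncard_lt_ncard ⟨?_, fun hsub => ?_⟩ (Set.toFinite _)))
    · rintro G ⟨hG, hcdG⟩
      refine ⟨hG, ?_⟩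
      rcases h.total hF hG with h1 | h1
      · exact h1 hab
      · exact absurd (h1 hcdG) hcd
    · exact hcd (hsub ⟨hF, hab⟩).2
  · intro hsub
    exact Set.ncard_le_ncard (fun F hF => ⟨hF.1, hsub F hF.1 hF.2⟩) (Set.toFinite _)

/-- Levels compare as the sets of members containing the pairs, so transitivity of flats becomes the
ultrametric inequality. A pair outside the largest member has level `0`; for the empty chain any
pair will do. -/
theorem isLevelFun_chainLevel (hm : 2 ≤ m) {𝓕 : Set (Set (Sym2 (Fin m)))}
    (h : IsChainOfFlats (matroidK m) 𝓕) : IsLevelFun (chainLevel 𝓕) where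
  symm a b := by rw [chainLevel, chainLevel, Sym2.eq_swap]
  ultra a b c hac := by
    rcases le_total (chainLevel 𝓕 a b) (chainLevel 𝓕 b c) with hle | hle
    · rw [min_eq_left hle, chainLevel_le_iff h.1]
      rw [chainLevel_le_iff h.1] at hle
      exact fun F hF hab => (isFlat_cycleMatroid_top_iff.1 (h.2 F hF).1).2 a b c hab
        (hle F hF hab) hac
    · rw [min_eq_right hle, chainLevel_le_iff h.1]
      rw [chainLevel_le_iff h.1] at hle
      exact fun F hF hbc => (isFlat_cycleMatroid_top_iff.1 (h.2 F hF).1).2 a b c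
        (hle F hF hbc) hbc hac
  exists_eq_zero := by
    have key : ∃ a b : Fin m, a ≠ b ∧ ∀ F ∈ 𝓕, s(a, b) ∉ F := by
      rcases 𝓕.eq_empty_or_nonempty with h0 | h0
      · exact ⟨⟨0, by omega⟩, ⟨1, by omega⟩, by simp, by simp [h0]⟩
      · obtain ⟨F, hF⟩ := (Set.toFinite 𝓕).exists_maximal h0
        obtain ⟨e, he, heF⟩ := Set.exists_of_ssubset
          ((h.2 F hF.prop).1.subset_ground.ssubset_of_ne (h.2 F hF.prop).2.2)
        induction e with
        | _ a b =>
        refine ⟨a, b, mk_mem_ground.1 he, fun G hG hab => heF ?_⟩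
        rcases h.1.total hF.prop hG with h1 | h1
        · exact hF.le_of_ge hG h1 hab
        · exact h1 hab
    obtain ⟨a, b, hab, h0⟩ := key
    refine ⟨a, b, hab, ?_⟩
    rw [chainLevel, Set.ncard_eq_zero (Set.toFinite _)]
    exact Set.eq_empty_of_forall_notMem fun F hF => h0 F hF.1 hF.2

theorem exists_levelChain_eq (hm : 2 ≤ m) {𝓕 : Set (Set (Sym2 (Fin m)))}
    (h : IsChainOfFlats (matroidK m) 𝓕) : ∃ C : RadialType m, C.levelChain = 𝓕 := by
  have : Fact (IsLevelFun (chainLevel 𝓕)) := ⟨isLevelFun_chainLevel hm h⟩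
  -- A pair for which `F` is the least member containing it has `F` as the flat of its level.
  have hflat : ∀ F ∈ 𝓕, ∀ a b : Fin m, a ≠ b → s(a, b) ∈ F →
      (∀ G ∈ 𝓕, s(a, b) ∈ G → F ⊆ G) → ∀ u : (Cluster.radialType (chainLevel 𝓕)).V,
      Cluster.lev (τ := chainLevel 𝓕) u = chainLevel 𝓕 a b →
      (Cluster.radialType (chainLevel 𝓕)).levelFlat u = F := by
    intro F hF a b hab habF hmin u hu
    ext e
    induction e with
    | _ c d =>
    rw [Cluster.mem_levelFlat_radialType, hu, chainLevel_le_iff h.1]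
    constructor
    · exact fun h' => h'.2 F hF habF
    · intro hcd
      exact ⟨mk_mem_ground.1 ((h.2 F hF).1.subset_ground hcd), fun G hG habG => hmin G hG habG hcd⟩
  refine ⟨Cluster.radialType (chainLevel 𝓕), ?_⟩
  ext F
  constructor
  · rintro ⟨u, hu, rfl⟩
    rw [Cluster.ne_root_iff] at hu
    obtain ⟨a, -, b, -, hab, hl⟩ := Cluster.exists_lev_eq (τ := chainLevel 𝓕) u
    rw [← hl, chainLevel] at hu
    obtain ⟨F, hF⟩ := (Set.toFinite {F ∈ 𝓕 | s(a, b) ∈ F}).exists_minimal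
      (Set.nonempty_of_ncard_ne_zero hu)
    rw [hflat F hF.prop.1 a b hab hF.prop.2 ?_ u hl.symm]
    · exact hF.prop.1
    · intro G hG habG
      rcases h.1.total hF.prop.1 hG with h1 | h1
      · exact h1
      · exact hF.le_of_le ⟨hG, habG⟩ h1
  · intro hF
    -- Each member `F` has such a pair: one outside the next smaller member, or any pair if there is
    -- none.
    have key : ∃ e ∈ F, ∀ G ∈ 𝓕, e ∈ G → F ⊆ G := by
      rcases Set.eq_empty_or_nonempty {G ∈ 𝓕 | G ⊂ F} with h0 | h0
      · obtain ⟨e, he⟩ := (h.2 F hF).2.1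
        refine ⟨e, he, fun G hG _ => ?_⟩
        rcases h.1.total hF hG with h1 | h1
        · exact h1
        · by_contra hn
          exact Set.notMem_empty G (h0 ▸ ⟨hG, h1, hn⟩)
      · obtain ⟨H, hH⟩ := (Set.toFinite {G ∈ 𝓕 | G ⊂ F}).exists_maximal h0
        obtain ⟨e, he, heH⟩ := Set.exists_of_ssubset hH.prop.2
        refine ⟨e, he, fun G hG heG => ?_⟩
        rcases h.1.total hF hG with h1 | h1
        · exact h1
        · by_contra hn
          rcases h.1.total hG hH.prop.1 with h2 | h2
          · exact heH (h2 heG)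
          · exact heH (hH.le_of_ge ⟨hG, h1, hn⟩ h2 heG)
    obtain ⟨e, he, hmin⟩ := key
    induction e with
    | _ a b =>
    have hab : a ≠ b := mk_mem_ground.1 ((h.2 F hF).1.subset_ground he)
    have hl := Cluster.lev_mk (τ := chainLevel 𝓕) this.out hab
    refine ⟨(Cluster.mk hab : Cluster (chainLevel 𝓕)), Cluster.ne_root_iff.2 ?_,
      (hflat F hF a b hab he hmin _ hl).symm⟩
    rw [hl, chainLevel]
    exact Set.ncard_ne_zero_of_mem (a := F) ⟨hF, he⟩ (Set.toFinite _)

theorem isPsi_psi (hm : 2 ≤ m) : IsPsi (psi m) where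
  ray T hT := T.psi_ray hT
  cone C := ⟨C.isChainOfFlats_levelChain, C.map_cone_psi⟩
  surj _ h := exists_levelChain_eq hm h

end ChainOfFlats

/-! ### Images and supports of collections of cones -/

section Images

variable {V W Z : Type*} [AddCommGroup V] [Module ℝ V] [AddCommGroup W] [Module ℝ W]
  [AddCommGroup Z] [Module ℝ Z]

theorem support_imageFan (f : V →ₗ[ℝ] W) (X : Set (PointedCone ℝ V)) :
    support (imageFan f X) = f '' support X := by
  simp only [support, imageFan, Set.biUnion_image, Set.image_iUnion, PointedCone.coe_map]

theorem imageFan_imageFan (g : W →ₗ[ℝ] Z) (f : V →ₗ[ℝ] W) (X : Set (PointedCone ℝ V)) :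
    imageFan g (imageFan f X) = imageFan (g ∘ₗ f) X := by
  simp only [imageFan, Set.image_image, PointedCone.map_map]

end Images

theorem imageFan_psi_radFan {m : ℕ} (hm : 2 ≤ m) :
    imageFan (psi m : Q (m + 1) →ₗ[ℝ] BergmanSpace (matroidK m)) (radFan m) =
      bergmanFan (matroidK m) := by
  ext c
  constructor
  · rintro ⟨_, ⟨C, rfl⟩, rfl⟩
    exact ⟨C.levelChain, C.isChainOfFlats_levelChain, C.map_cone_psi⟩
  · rintro ⟨𝓕, h𝓕, rfl⟩
    obtain ⟨C, rfl⟩ := exists_levelChain_eq hm h𝓕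
    exact ⟨C.cone, ⟨C, rfl⟩, C.map_cone_psi⟩

/-! ### The supports of the two moduli fans agree -/

/-- Nonnegative edge lengths are compatible with a radial alignment: align by the distances for
slightly larger edge lengths. -/
theorem CombType.exists_radialType {m : ℕ} (T : CombType (m + 1)) {l : T.Edge → ℝ}
    (hl : ∀ e, 0 ≤ l e) : T.curveVec l ∈ support (radFan m) := by
  -- Strict inequalities between root distances survive small perturbations, so the alignment
  -- defined by `l + ε` is weakly respected by `l`.
  have hε : ∀ᶠ ε : ℝ in nhdsWithin 0 (Set.Ioi 0), ∀ u v : T.V,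
      T.rootDist v l < T.rootDist u l →
      T.rootDist v (l + ε • 1) < T.rootDist u (l + ε • 1) := by
    refine Filter.Eventually.filter_mono nhdsWithin_le_nhds ?_
    rw [Filter.eventually_all]
    intro u
    rw [Filter.eventually_all]
    intro v
    by_cases huv : T.rootDist v l < T.rootDist u l
    · have hc : ∀ w : T.V, ContinuousAt (fun ε : ℝ => T.rootDist w (l + ε • 1)) 0 := by
        intro w
        simp only [map_add, map_smul, smul_eq_mul]
        fun_prop
      have := (hc v).eventually_lt (hc u) (by simpa using huv)
      exact this.mono fun ε h _ => h
    · exact Filter.Eventually.of_forall fun ε h => absurd h huv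
  obtain ⟨ε, hε, hpos⟩ := (hε.and self_mem_nhdsWithin).exists
  have hpos : 0 < ε := hpos
  let C : RadialType m :=
    { T with
      le := fun u v => T.rootDist u (l + ε • 1) ≤ T.rootDist v (l + ε • 1)
      aligned := ⟨l + ε • 1, fun e => by
        have := hl e
        change 0 < l e + ε * 1
        linarith, fun u v => Iff.rfl⟩ }
  refine Set.mem_biUnion (show C.cone ∈ radFan m from ⟨C, rfl⟩) ⟨l, ⟨hl, fun u v huv => ?_⟩, rfl⟩
  by_contra! hlt
  exact absurd huv (not_le.2 (hε u v hlt))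

theorem support_tropFan (m : ℕ) : support (tropFan (m + 1)) = support (radFan m) := by
  apply Set.Subset.antisymm
  · refine Set.iUnion₂_subset ?_
    rintro _ ⟨T, rfl⟩ _ ⟨l, hl, rfl⟩
    exact T.exists_radialType hl
  · refine Set.iUnion₂_subset ?_
    rintro _ ⟨C, rfl⟩ _ ⟨l, hl, rfl⟩
    exact Set.mem_biUnion (show C.toCombType.cone ∈ tropFan (m + 1) from ⟨_, rfl⟩)
      ⟨l, hl.1, rfl⟩

/-! ### The subspaces that are projected out -/

section Spans

variable {m : ℕ} (Γ : SimpleGraph (Fin m))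

theorem mkQ_mem_nonEdgeSpan {w : (matroidK m).E → ℝ}
    (hw : ∀ e : (matroidK m).E, (e : Sym2 (Fin m)) ∈ Γ.edgeSet → w e = 0) :
    (lineality (matroidK m)).mkQ w ∈ nonEdgeSpan Γ := by
  classical
  have : Fintype (matroidK m).E := Fintype.ofFinite _
  have hsum : w = ∑ e, w e • Pi.single e (1 : ℝ) := by
    ext e
    simp [Finset.sum_apply, Pi.single_apply]
  rw [hsum, map_sum]
  refine Submodule.sum_mem _ fun e _ => ?_
  rw [map_smul]
  by_cases he : (e : Sym2 (Fin m)) ∈ Γ.edgeSet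
  · rw [hw e he, zero_smul]
    exact zero_mem _
  · refine Submodule.smul_mem _ _ (Submodule.subset_span ⟨e, he, ?_⟩)
    congr!

theorem mkQ_mem_nonEdgeSpan_iff {w : (matroidK m).E → ℝ} :
    (lineality (matroidK m)).mkQ w ∈ nonEdgeSpan Γ ↔
      ∃ c, ∀ e : (matroidK m).E, (e : Sym2 (Fin m)) ∈ Γ.edgeSet → w e = c := by
  constructor
  · intro h
    have key : ∃ w' : (matroidK m).E → ℝ,
        (∀ e : (matroidK m).E, (e : Sym2 (Fin m)) ∈ Γ.edgeSet → w' e = 0) ∧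
        (lineality (matroidK m)).mkQ w' = (lineality (matroidK m)).mkQ w := by
      refine Submodule.span_induction (p := fun x _ => ∃ w' : (matroidK m).E → ℝ,
        (∀ e : (matroidK m).E, (e : Sym2 (Fin m)) ∈ Γ.edgeSet → w' e = 0) ∧
        (lineality (matroidK m)).mkQ w' = x) ?_ ?_ ?_ ?_ h
      · rintro x ⟨e, he, rfl⟩
        refine ⟨_, fun e' he' => ?_, rfl⟩
        exact Pi.single_eq_of_ne (fun h : e' = e => he (h ▸ he')) _
      · exact ⟨0, fun _ _ => rfl, map_zero _⟩
      · rintro x y - - ⟨a, ha, rfl⟩ ⟨b, hb, rfl⟩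
        exact ⟨a + b, fun e he => by simp [ha e he, hb e he], map_add _ _ _⟩
      · rintro c x - ⟨a, ha, rfl⟩
        exact ⟨c • a, fun e he => by simp [ha e he], map_smul _ _ _⟩
    obtain ⟨w', hw', heq⟩ := key
    rw [eq_comm, Submodule.mkQ_apply, Submodule.mkQ_apply, Submodule.Quotient.eq,
      mem_lineality_iff] at heq
    obtain ⟨c, hc⟩ := heq
    refine ⟨c, fun e he => ?_⟩
    have := hc e
    rwa [Pi.sub_apply, hw' e he, sub_zero] at this
  · rintro ⟨c, hc⟩
    have h0 : (lineality (matroidK m)).mkQ (fun _ => c) = 0 := by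
      rw [Submodule.mkQ_apply, Submodule.Quotient.mk_eq_zero, mem_lineality_iff]
      exact ⟨c, fun _ => rfl⟩
    rw [← sub_zero ((lineality (matroidK m)).mkQ w), ← h0, ← map_sub]
    exact mkQ_mem_nonEdgeSpan Γ fun e he => sub_eq_zero.2 (hc e he)

/-- The root carries the end `0`, so instability sits at the other vertex. An edge of `Γ` between
two ends there would make it stable; so `K_I` contains no edge of `Γ`. -/
theorem psi_unstable_mem {T : CombType (m + 1)} (hT : T.graph.edgeSet.ncard = 1)
    (hs : ¬ GammaStable Γ T) : psi m (T.curveVec fun _ => 1) ∈ nonEdgeSpan Γ := by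
  rw [T.psi_ray hT]
  have hs' : ∃ v, v ≠ T.root ∧ ¬ GammaStableAt Γ T v := by
    by_contra! h
    exact hs ⟨h, Or.inr ⟨0, rfl⟩⟩
  obtain ⟨v, hv, hun⟩ := hs'
  refine mkQ_mem_nonEdgeSpan Γ fun e he => ?_
  rw [Pi.neg_apply, neg_eq_zero]
  refine Set.indicator_of_notMem ?_ _
  rintro ⟨a, b, hab, hes, ha, hb⟩
  rw [hes] at he
  refine hun (Or.inr (Or.inr ⟨?_, a, b, he, T.eq_of_ncard_eq_one hT ha hv,
    T.eq_of_ncard_eq_one hT hb hv⟩))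
  rw [Set.ncard_eq_one]
  refine ⟨T.root, Set.eq_singleton_iff_unique_mem.2
    ⟨(T.isParent_root_of_ncard_eq_one hT hv).1.symm, fun w hw => ?_⟩⟩
  by_contra hwr
  have hw : T.graph.Adj v w := hw
  exact hw.ne (T.eq_of_ncard_eq_one hT hv hwr)

theorem ncard_neighborSet_top_bool (v : Bool) :
    ((⊤ : SimpleGraph Bool).neighborSet v).ncard = 1 := by
  rw [Set.ncard_eq_one]
  refine ⟨!v, ?_⟩
  ext w
  cases v <;> cases w <;> simp

theorem ncard_edgeSet_top_bool : (⊤ : SimpleGraph Bool).edgeSet.ncard = 1 := by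
  rw [Set.ncard_eq_one]
  refine ⟨s(false, true), ?_⟩
  ext e
  induction e with
  | _ a b => cases a <;> cases b <;> simp

/-- The type with one bounded edge whose ends away from the root are `a` and `b`. -/
def pairType {a b c : Fin m} (hab : a ≠ b) (hac : a ≠ c) (hbc : b ≠ c) : CombType (m + 1) where
  V := Bool
  graph := ⊤
  isTree := ⟨SimpleGraph.connected_top, SimpleGraph.IsAcyclic.of_card_le_two (by simp)⟩
  mark := Fin.cons false fun i => decide (i = a ∨ i = b)
  stable v := by
    rw [ncard_neighborSet_top_bool]
    have h2 : ∀ {i j : Fin (m + 1)} {s : Set (Fin (m + 1))}, i ≠ j → i ∈ s → j ∈ s →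
        3 ≤ 1 + s.ncard := by
      intro i j s hij hi hj
      have h1 : 1 < s.ncard := (Set.one_lt_ncard (Set.toFinite _)).2 ⟨i, hi, j, hj, hij⟩
      omega
    cases v
    · exact h2 (i := 0) (j := c.succ) (Fin.succ_ne_zero c).symm rfl
        (by simp [hac.symm, hbc.symm])
    · exact h2 (i := a.succ) (j := b.succ) (by simpa using hab) (by simp) (by simp)

/-- For the reverse inclusion, `v_e` with `e = ab` not in `Γ` is minus the ray of the unstable curve
that splits off `a` and `b`. -/
theorem map_psi_unstableSpan (hΓ : Γ.Connected) :
    (unstableSpan Γ).map (psi m : Q (m + 1) →ₗ[ℝ] BergmanSpace (matroidK m)) = nonEdgeSpan Γ := by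
  classical
  apply le_antisymm
  · rw [unstableSpan, Submodule.map_span, Submodule.span_le]
    rintro _ ⟨_, ⟨T, hT, hs, rfl⟩, rfl⟩
    exact psi_unstable_mem Γ hT hs
  · rw [nonEdgeSpan, Submodule.span_le]
    rintro _ ⟨e, he, rfl⟩
    revert e
    refine ground_induction fun a b hab he => ?_
    have he : ¬ Γ.Adj a b := he
    -- The root needs another end `c` to be stable. A path in `Γ` from `a` to the nonadjacent `b`
    -- supplies it.
    obtain ⟨c, hac, hbc⟩ : ∃ c, a ≠ c ∧ b ≠ c := by
      obtain ⟨p⟩ := hΓ.preconnected a b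
      cases p with
      | nil => exact absurd rfl hab
      | @cons _ c _ hadj q =>
        exact ⟨c, hadj.ne, by rintro rfl; exact he hadj⟩
    let T : CombType (m + 1) := pairType hab hac hbc
    have hmark : ∀ i : Fin m, T.mark i.succ ≠ T.root ↔ i = a ∨ i = b := by
      intro i
      change decide (i = a ∨ i = b) ≠ false ↔ _
      rw [ne_eq, Bool.not_eq_false, decide_eq_true_iff]
    have hT : T.graph.edgeSet.ncard = 1 := ncard_edgeSet_top_bool
    have hs : ¬ GammaStable Γ T := by
      rintro ⟨h, -⟩
      have hN : (T.graph.neighborSet true).ncard = 1 := ncard_neighborSet_top_bool true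
      rcases h true Bool.noConfusion with h | ⟨h, -⟩ | ⟨-, i, j, hij, hi, hj⟩
      · omega
      · omega
      · have hi := (hmark i).1 (by rw [hi]; exact Bool.noConfusion)
        have hj := (hmark j).1 (by rw [hj]; exact Bool.noConfusion)
        rcases hi with rfl | rfl <;> rcases hj with rfl | rfl
        · exact hij.ne rfl
        · exact he hij
        · exact he hij.symm
        · exact hij.ne rfl
    have hmem : -(T.curveVec fun _ => 1) ∈ unstableSpan Γ :=
      neg_mem (Submodule.subset_span ⟨T, hT, hs, rfl⟩)
    refine ⟨_, hmem, ?_⟩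
    rw [map_neg]
    change -(psi m _) = _
    rw [T.psi_ray hT, flatRay, ← map_neg, neg_neg]
    congr 1
    ext e
    revert e
    refine ground_induction fun c d hcd => ?_
    simp only [Set.indicator_apply, Pi.single_apply, Set.mem_ofPred_eq, Pi.one_apply,
      Subtype.mk.injEq]
    refine if_congr ?_ rfl rfl
    constructor
    · rintro ⟨c', d', hne, hcd', hc, hd⟩
      rw [hmark] at hc hd
      rw [hcd']
      rcases hc with rfl | rfl <;> rcases hd with rfl | rfl
      · exact absurd rfl hne
      · rfl
      · exact Sym2.eq_swap
      · exact absurd rfl hne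
    · intro h
      exact ⟨a, b, hab, h, (hmark a).2 (Or.inl rfl), (hmark b).2 (Or.inr rfl)⟩

/-! ### The projected Bergman fan is a fan -/

/-- The edges of `Γ`, as a subset of the ground set. -/
abbrev GraphEdge : Type := {e : (matroidK m).E // (e : Sym2 (Fin m)) ∈ Γ.edgeSet}

/-- Restriction of functions to the edges of `Γ`. -/
def restrictEdges : ((matroidK m).E → ℝ) →ₗ[ℝ] (GraphEdge Γ → ℝ) :=
  LinearMap.funLeft ℝ ℝ Subtype.val

/-- The trace of a set of edges of the complete graph on the edges of `Γ`. -/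
def trace (F : Set (Sym2 (Fin m))) : Set (GraphEdge Γ) := {e | (e.1 : Sym2 (Fin m)) ∈ F}

/-- The cone of functions on `E(K_{n-1})` over the cone of a chain of flats. -/
def liftedCone (𝓕 : Set (Set (Sym2 (Fin m)))) : PointedCone ℝ ((matroidK m).E → ℝ) :=
  indicatorCone ((fun F => {e : (matroidK m).E | (e : Sym2 (Fin m)) ∈ F}) '' 𝓕)

/-- The sign of `ρ_F` is moved into the map, so that cones are described by nonnegative functions.
-/
theorem flatCone_eq_map (𝓕 : Set (Set (Sym2 (Fin m)))) :
    flatCone (matroidK m) 𝓕 = (liftedCone 𝓕).map (-(lineality (matroidK m)).mkQ) := by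
  rw [liftedCone, indicatorCone, map_hull, flatCone, Set.image_image, Set.image_image]
  congr 1

theorem map_restrictEdges_liftedCone (𝓕 : Set (Set (Sym2 (Fin m)))) :
    (liftedCone 𝓕).map (restrictEdges Γ) = indicatorCone (trace Γ '' 𝓕) := by
  rw [liftedCone, indicatorCone, indicatorCone, map_hull, Set.image_image, Set.image_image,
    Set.image_image]
  rfl

theorem isChain_trace {𝓕 : Set (Set (Sym2 (Fin m)))} (h : IsChain (· ⊆ ·) 𝓕) :
    IsChain (· ⊆ ·) (trace Γ '' 𝓕) := by
  rintro _ ⟨F, hF, rfl⟩ _ ⟨G, hG, rfl⟩ -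
  rcases h.total hF hG with h | h
  · exact Or.inl fun e he => h he
  · exact Or.inr fun e he => h he

/-- A flat that contains all edges of the connected graph `Γ` contains every pair, by transitivity
along paths. -/
theorem univ_notMem_trace (hΓ : Γ.Connected) {𝓕 : Set (Set (Sym2 (Fin m)))}
    (h : IsChainOfFlats (matroidK m) 𝓕) : Set.univ ∉ trace Γ '' 𝓕 := by
  rintro ⟨F, hF, hu⟩
  obtain ⟨hflat, -, hne⟩ := h.2 F hF
  refine hne (hflat.subset_ground.antisymm fun e he => ?_)
  induction e with
  | _ a b =>
  have hab := mk_mem_ground.1 he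
  refine mem_of_reachable_fromEdgeSet (isFlat_cycleMatroid_top_iff.1 hflat).2 hab
    ((hΓ.preconnected a b).mono fun u v huv => ?_)
  rw [SimpleGraph.fromEdgeSet_adj]
  have : (⟨⟨s(u, v), mk_mem_ground.2 huv.ne⟩, huv⟩ : GraphEdge Γ) ∈ trace Γ F := by
    rw [hu]
    trivial
  exact ⟨this, huv.ne⟩

variable {W : Type*} [AddCommGroup W] [Module ℝ W] {f : BergmanSpace (matroidK m) →ₗ[ℝ] W}

/-- This is the face property of intersections. Only the kernel of `f` matters, so it serves both
sides of the identification. -/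
theorem mem_map_flatCone_of_add_mem (hm : 2 ≤ m) (hΓ : Γ.Connected)
    (hf : LinearMap.ker f = nonEdgeSpan Γ) {𝓕 𝓖 : Set (Set (Sym2 (Fin m)))}
    (h𝓕 : IsChainOfFlats (matroidK m) 𝓕) (h𝓖 : IsChainOfFlats (matroidK m) 𝓖) {x y : W}
    (hx : x ∈ (flatCone (matroidK m) 𝓕).map f) (hy : y ∈ (flatCone (matroidK m) 𝓕).map f)
    (hxy : x + y ∈ (flatCone (matroidK m) 𝓖).map f) : x ∈ (flatCone (matroidK m) 𝓖).map f := by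
  have : Nonempty (GraphEdge Γ) := by
    have : Nontrivial (Fin m) := Fin.nontrivial_iff_two_le.2 hm
    obtain ⟨b, hb⟩ := hΓ.preconnected.exists_adj_of_nontrivial (⟨0, by omega⟩ : Fin m)
    exact ⟨⟨⟨s(_, b), mk_mem_ground.2 hb.ne⟩, hb⟩⟩
  have hker : ∀ φ ψ : (matroidK m).E → ℝ,
      (f ∘ₗ (-(lineality (matroidK m)).mkQ)) φ = (f ∘ₗ (-(lineality (matroidK m)).mkQ)) ψ ↔
      ∃ c, ∀ e, restrictEdges Γ φ e = restrictEdges Γ ψ e + c := by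
    intro φ ψ
    have h1 : (f ∘ₗ (-(lineality (matroidK m)).mkQ)) φ = (f ∘ₗ (-(lineality (matroidK m)).mkQ)) ψ ↔
        (lineality (matroidK m)).mkQ (φ - ψ) ∈ nonEdgeSpan Γ := by
      rw [← hf, LinearMap.mem_ker, map_sub, map_sub, sub_eq_zero]
      simp
    rw [h1, mkQ_mem_nonEdgeSpan_iff]
    constructor
    · rintro ⟨c, hc⟩
      exact ⟨c, fun e => sub_eq_iff_eq_add'.1 (hc e.1 e.2)⟩
    · rintro ⟨c, hc⟩
      exact ⟨c, fun e he => sub_eq_iff_eq_add'.2 (hc ⟨e, he⟩)⟩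
  rw [flatCone_eq_map, PointedCone.map_map] at hx hy hxy ⊢
  obtain ⟨φ, hφ, rfl⟩ := PointedCone.mem_map.1 hx
  obtain ⟨ψ, hψ, rfl⟩ := PointedCone.mem_map.1 hy
  obtain ⟨χ, hχ, hsum⟩ := PointedCone.mem_map.1 hxy
  have hres : ∀ {𝓕 : Set (Set (Sym2 (Fin m)))} {φ : (matroidK m).E → ℝ}, φ ∈ liftedCone 𝓕 →
      restrictEdges Γ φ ∈ indicatorCone (trace Γ '' 𝓕) := by
    intro 𝓕 φ h
    rw [← map_restrictEdges_liftedCone]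
    exact PointedCone.mem_map.2 ⟨φ, h, rfl⟩
  have hc𝓕 := isChain_trace Γ h𝓕.1
  have hc𝓖 := isChain_trace Γ h𝓖.1
  rw [← map_add, hker] at hsum
  obtain ⟨c, hc⟩ := hsum
  have h1 := hres (add_mem hφ hψ)
  have h2 := hres hχ
  obtain ⟨e, he⟩ := exists_eq_zero_of_mem_indicatorCone hc𝓕 (univ_notMem_trace Γ hΓ h𝓕) h1
  obtain ⟨e', he'⟩ := exists_eq_zero_of_mem_indicatorCone hc𝓖 (univ_notMem_trace Γ hΓ h𝓖) h2
  -- Both restrictions are nonnegative and vanish somewhere, so both have minimum `0`.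
  have hc0 : c = 0 := by
    have h3 := (superlevelIn_of_mem_indicatorCone hc𝓕 h1).1 e'
    have h4 := (superlevelIn_of_mem_indicatorCone hc𝓖 h2).1 e
    have h5 := hc e
    have h6 := hc e'
    linarith
  have heq : restrictEdges Γ φ + restrictEdges Γ ψ = restrictEdges Γ χ := by
    rw [← map_add]
    ext e
    rw [hc e, hc0, add_zero]
  have h3 := mem_indicatorCone_of_add_mem hc𝓕 hc𝓖 (hres hφ) (hres hψ) (heq ▸ h2)
  rw [← map_restrictEdges_liftedCone] at h3
  obtain ⟨φ', hφ', hres'⟩ := PointedCone.mem_map.1 h3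
  refine PointedCone.mem_map.2 ⟨φ', hφ', (hker _ _).2 ⟨0, fun e => ?_⟩⟩
  rw [hres', add_zero]

theorem isFan_imageFan_bergmanFan (hm : 2 ≤ m) (hΓ : Γ.Connected)
    (hf : LinearMap.ker f = nonEdgeSpan Γ) :
    IsFan (imageFan f (bergmanFan (matroidK m))) where
  finite := by
    refine Set.Finite.image _ ((Set.finite_range (flatCone (matroidK m))).subset ?_)
    rintro _ ⟨𝓕, -, rfl⟩
    exact ⟨𝓕, rfl⟩
  nonempty := ⟨_, _, ⟨∅, ⟨Set.pairwise_empty _, by simp⟩, rfl⟩, rfl⟩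
  fg := by
    rintro _ ⟨_, ⟨𝓕, -, rfl⟩, rfl⟩
    rw [flatCone, map_hull]
    exact Submodule.fg_span (Set.toFinite _)
  face_mem := by
    rintro _ ⟨_, ⟨𝓕, h𝓕, rfl⟩, rfl⟩ F hF
    rw [flatCone, map_hull, Set.image_image] at hF
    -- A face is generated by the generators that it contains, hence comes from a subchain.
    refine ⟨_, ⟨{G ∈ 𝓕 | f (flatRay (matroidK m) G) ∈ F},
      ⟨h𝓕.1.mono fun G hG => hG.1, fun G hG => h𝓕.2 G hG.1⟩, rfl⟩, ?_⟩
    rw [flatCone, map_hull, Set.image_image, eq_hull_inter_of_isFaceOf_hull hF]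
    congr 1
    ext x
    rw [← eq_hull_inter_of_isFaceOf_hull hF]
    constructor
    · rintro ⟨G, ⟨hG, hGF⟩, rfl⟩
      exact ⟨⟨G, hG, rfl⟩, hGF⟩
    · rintro ⟨⟨G, hG, rfl⟩, hGF⟩
      exact ⟨G, ⟨hG, hGF⟩, rfl⟩
  inter_face := by
    rintro _ ⟨_, ⟨𝓕, h𝓕, rfl⟩, rfl⟩ _ ⟨_, ⟨𝓖, h𝓖, rfl⟩, rfl⟩
    constructor
    · exact PointedCone.IsFaceOf.of_mem_of_add_mem_left inf_le_left fun hx hy hxy =>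
        ⟨hx, mem_map_flatCone_of_add_mem Γ hm hΓ hf h𝓕 h𝓖 hx hy hxy.2⟩
    · exact PointedCone.IsFaceOf.of_mem_of_add_mem_left inf_le_right fun hx hy hxy =>
        ⟨mem_map_flatCone_of_add_mem Γ hm hΓ hf h𝓖 h𝓕 hx hy hxy.1, hx⟩

end Spans

end TropModuli

end

theorem mainTheorem4 (m : ℕ) (hm : 2 ≤ m) (Γ : SimpleGraph (Fin m)) (hΓ : Γ.Connected) :
    ∃ Ψ : TropModuli.Q (m + 1) ≃ₗ[ℝ] TropModuli.BergmanSpace (TropModuli.matroidK m),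
      TropModuli.IsPsi Ψ ∧
      ∃ Ψ' : (TropModuli.Q (m + 1) ⧸ TropModuli.unstableSpan Γ) ≃ₗ[ℝ]
          (TropModuli.BergmanSpace (TropModuli.matroidK m) ⧸ TropModuli.nonEdgeSpan Γ),
        -- the square formed by `Ψ`, `Ψ'` and the two projections commutes
        (∀ x, Ψ' (TropModuli.projQ Γ x) = TropModuli.projB Γ (Ψ x)) ∧
        -- the three projections have the same support
        Ψ' '' TropModuli.support
            (TropModuli.imageFan (TropModuli.projQ Γ) (TropModuli.radFan m)) =
          TropModuli.support (TropModuli.imageFan (TropModuli.projB Γ)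
            (TropModuli.bergmanFan (TropModuli.matroidK m))) ∧
        Ψ' '' TropModuli.support
            (TropModuli.imageFan (TropModuli.projQ Γ) (TropModuli.tropFan (m + 1))) =
          TropModuli.support (TropModuli.imageFan (TropModuli.projB Γ)
            (TropModuli.bergmanFan (TropModuli.matroidK m))) ∧
        -- two of the projections are fans, and they are the same fan
        TropModuli.IsFan (TropModuli.imageFan (TropModuli.projQ Γ) (TropModuli.radFan m)) ∧
        TropModuli.IsFan (TropModuli.imageFan (TropModuli.projB Γ)
          (TropModuli.bergmanFan (TropModuli.matroidK m))) ∧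
        TropModuli.imageFan (Ψ' : _ →ₗ[ℝ] _)
            (TropModuli.imageFan (TropModuli.projQ Γ) (TropModuli.radFan m)) =
          TropModuli.imageFan (TropModuli.projB Γ)
            (TropModuli.bergmanFan (TropModuli.matroidK m)) := by
  open TropModuli in
  let Ψ' : (Q (m + 1) ⧸ unstableSpan Γ) ≃ₗ[ℝ] (BergmanSpace (matroidK m) ⧸ nonEdgeSpan Γ) :=
    Submodule.Quotient.equiv _ _ (psi m) (map_psi_unstableSpan Γ hΓ)
  have hsq : ∀ x, Ψ' (projQ Γ x) = projB Γ (psi m x) := fun x => rfl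
  have hsq' : (Ψ' : _ →ₗ[ℝ] _) ∘ₗ projQ Γ = projB Γ ∘ₗ (psi m : Q (m + 1) →ₗ[ℝ] _) :=
    LinearMap.ext hsq
  have hfan : imageFan (Ψ' : _ →ₗ[ℝ] _) (imageFan (projQ Γ) (radFan m)) =
      imageFan (projB Γ) (bergmanFan (matroidK m)) := by
    rw [imageFan_imageFan, hsq', ← imageFan_imageFan, imageFan_psi_radFan hm]
  have hsupp : Ψ' '' support (imageFan (projQ Γ) (radFan m)) =
      support (imageFan (projB Γ) (bergmanFan (matroidK m))) := by
    rw [← hfan]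
    exact (support_imageFan Ψ'.toLinearMap _).symm
  have hkerB : LinearMap.ker (projB Γ) = nonEdgeSpan Γ := Submodule.ker_mkQ _
  -- The projected radial fan is an image of the Bergman fan under a map with kernel `S`, so the
  -- same fan criterion applies to it.
  have hrad : imageFan (projQ Γ) (radFan m) =
      imageFan ((Ψ'.symm : _ →ₗ[ℝ] _) ∘ₗ projB Γ) (bergmanFan (matroidK m)) := by
    rw [← imageFan_imageFan, ← hfan, imageFan_imageFan, LinearEquiv.comp_coe,
      LinearEquiv.self_trans_symm]
    simp [imageFan]
  refine ⟨psi m, isPsi_psi hm, Ψ', hsq, hsupp, ?_, ?_,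
    isFan_imageFan_bergmanFan Γ hm hΓ hkerB, hfan⟩
  · rw [support_imageFan, support_tropFan, ← support_imageFan]
    exact hsupp
  · rw [hrad]
    refine isFan_imageFan_bergmanFan Γ hm hΓ ?_
    rw [LinearEquiv.ker_comp, hkerB]
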